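/- **Networks.** A *perfect cylindrical network* $\Gamma$ is a finite directed multigraph without oriented cycles, embedded in an oriented cylinder, such that boundary vertices are univalent, internal vertices are trivalent, and no internal vertex is a source or a sink; all $m$ sources lie on one boundary circle (left) and all $n$ sinks on the other (right). So each internal vertex is *white* (a unique incoming edge) or *black* (a unique outgoing edge). Fix a *cut*: a curve oriented from the left to the right boundary circle, avoiding the vertices and crossing edges transversally. Cutting the cylinder along it gives a rectangle; sources and sinks are numbered $1,\dots,m$ and $1,\dots,n$ from top to bottom along its left and right sides, the cut being the top and bottom side (the orientation of the cylinder being that of the plane). **Double bracket.** Let $\mathbf k=\mathbb C(\lambda,\mu)$ and let $\mathcal C$ be the $\mathbf k$-linear category generated by the free groupoid on $\Gamma$, with composition written as concatenation of paths, $\otimes=\otimes_{\mathbf k}$, and $(f\otimes g)^\tau=g\otimes f$. Choose scalars $w_{12},w_{13},w_{23},b_{12},b_{13},b_{23}\in\mathbf k$ with $$w_{12}+w_{13}-w_{23}=\tfrac12,\qquad b_{12}+b_{13}-b_{23}=-\tfrac12$$ (for instance $w_{12}=\frac12$, $b_{12}=-\frac12$ and all others $0$). At a white vertex $V$ let $x_1,x_2,x_3$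 be the edges in counterclockwise order with the incoming edge $x_3$ last; at a black vertex $V$ let $y_1,y_2,y_3$ be the edges in counterclockwise order with the outgoing edge $y_3$ last. The double bracket $⟦\cdot,\cdot⟧$ on $\mathcal C$ is the $\mathbf k$-bilinear, skew-symmetric ($⟦f,g⟧=-⟦g,f⟧^\tau$) operation satisfying the double Leibniz rules $$⟦fg,h⟧=(1\otimes f)⟦g,h⟧+⟦f,h⟧(g\otimes 1),\qquad ⟦f,gh⟧=(g\otimes1)⟦f,h⟧+⟦f,g⟧(1\otimes h),$$ whose value on a pair of edges is the sum of the contributions of all internal vertices, the nonzero contributions being, up to skew-symmetry, $$⟦x_1,x_2⟧=w_{12}\,x_1\otimes x_2,\quad ⟦x_1,x_3⟧=w_{13}\,x_3x_1\otimes 1_V,\quad ⟦x_2,x_3⟧=w_{23}\,x_3x_2\otimes 1_V,$$ $$⟦y_1,y_2⟧=b_{12}\,y_2\otimes y_1,\quad ⟦y_1,y_3⟧=b_{13}\,1_V\otimes y_1y_3,\quad ⟦y_2,y_3⟧=b_{23}\,1_V\otimes y_2y_3 .$$ **Boundary measurements.** $B(\lambda)$ is the $m\times n$ matrix with entries $$b_{ij}(\lambda)=\sum_{p:i\to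 j}\lambda^{d(p)}\,\mathrm{wt}(p),$$ the sum being over directed paths $p$ from source $i$ to sink $j$, where $\mathrm{wt}(p)\in\mathcal C$ is the product of the edges of $p$ and $d(p)$ is the oriented intersection index of $p$ with the cut (a crossing from the right-hand side to the left-hand side of the cut counts $+1$, the opposite one $-1$). **Matrices.** $\boxtimes$ is the Kronecker product of matrices. For matrices $X,Y$ over $\mathcal C$ put $⟦X,Y⟧=\sum ⟦x_{ij},y_{kl}⟧\,E_{ij}\boxtimes E_{kl}$; $X_L$ and $X_R$ have entries $x_{ij}\otimes1$ and $1\otimes x_{ij}$; $\tau$ acts on matrices over $\mathcal C\otimes\mathcal C$ entrywise; and $$r_n(\lambda,\mu)=\frac12\,\frac{\mu+\lambda}{\mu-\lambda}\sum_{a=1}^nE_{aa}\boxtimes E_{aa}+\frac1{\mu-\lambda}\sum_{1\le i<j\le n}\bigl(\lambda\,E_{ij}\boxtimes E_{ji}+\mu\,E_{ji}\boxtimes E_{ij}\bigr).$$ **Theorem.** For every perfect cylindrical network with $m$ sources and $n$ sinks, $$⟦B(\lambda),B(\mu)⟧=r_m(\lambda,\mu)\bigl(B_L(\lambda)\boxtimes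 B_R(\mu)\bigr)-\Bigl(\bigl(B_L(\lambda)\boxtimes B_R(\mu)\bigr)\,r_n(\lambda,\mu)\Bigr)^\tau .$$ In particular, if $m=n$, then $⟦B(\lambda),B(\mu)⟧=\bigl[r_n(\lambda,\mu),\,B_L(\lambda)\boxtimes B_R(\mu)\bigr]_\tau$, where $[A,B]_\tau=AB-(BA)^\tau$. -/

import Mathlib

open scoped TensorProduct

noncomputable section

/-- The vertices of a network: `m` sources on the left boundary circle, `n` sinks on the right
boundary circle, and the internal vertices `V`. -/
inductive NetVertex (m n : ℕ) (V : Type*) where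
  | source (i : Fin m)
  | inner (v : V)
  | sink (j : Fin n)
  deriving DecidableEq, Fintype

/-- Combinatorial data of a directed multigraph with edge set `E` drawn on a cylinder, together
with a cut.  A half-edge is a pair `(e, b)`: `(e, true)` is the half of `e` at its tail (it also
stands for `e` traversed forwards), `(e, false)` is the half of `e` at its head (and `e` traversed
backwards).

The cylinder is drawn as a rectangle whose top and bottom edges are identified, with the sources on
the left boundary and the sinks on the right one.  Contracting each boundary circle to a point
makes it an oriented sphere.
* `rot` sends a half-edge to the next one in counterclockwise order around its endpoint, where the
  left boundary circle and the right boundary circle each count as one point of the sphere.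
* `cut` lists the half-edges crossed by the cut, a curve from the left to the right boundary
  circle, in the order of crossing; `d ∈ cut` means that the cut passes from the
  left-hand side of `d` to its right-hand side (`d` pointing away from its endpoint).
  Thus `d`, as a direction of travel, passes from the right-hand to the left-hand side of the cut
  (that is, upwards if the cut goes from left to right). -/
structure CylNetwork (m n : ℕ) (V E : Type*) where
  tail : E → NetVertex m n V
  head : E → NetVertex m n V
  rot : Equiv.Perm (E × Bool)
  cut : List (E × Bool)

namespace CylNetwork

/-- The number of cycles of a permutation, fixed points included. -/
def numCycles {X : Type*} (f : Equiv.Perm X) : ℕ :=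
  Nat.card (Quotient (Equiv.Perm.SameCycle.setoid f))

variable {m n : ℕ} {V E : Type*} (Γ : CylNetwork m n V E)

/-- The vertex at which a half-edge is attached. -/
def base (d : E × Bool) : NetVertex m n V := if d.2 then Γ.tail d.1 else Γ.head d.1

/-- The other half of the same edge. -/
def rev : Equiv.Perm (E × Bool) := Equiv.prodCongr (Equiv.refl E) Equiv.boolNot

/-- The cycles of this permutation are the faces (regions) of the drawing: `d` belongs to the face
on the left-hand side of `d`, and `faceRot d` is the next step along the boundary of that face. -/
def faceRot : Equiv.Perm (E × Bool) := Γ.rot⁻¹ * rev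

/-- The number of connected components of the graph in which all the sources are identified with
each other and all the sinks are identified with each other. -/
def numComponents : ℕ :=
  Nat.card (MulAction.orbitRel.Quotient (Subgroup.closure {Γ.rot, rev}) (E × Bool))

/-- Boundary vertices are univalent, with sources on the left and sinks on the right boundary;
internal vertices are trivalent and are neither sources nor sinks. -/
structure IsPerfect : Prop where
  source_univalent : ∀ i, ∃! d, Γ.base d = .source i
  source_out : ∀ i e, Γ.head e ≠ .source i
  sink_univalent : ∀ j, ∃! d, Γ.base d = .sink j
  sink_in : ∀ j e, Γ.tail e ≠ .sink j
  trivalent : ∀ v, Nat.card {d // Γ.base d = .inner v} = 3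
  inner_not_source : ∀ v, ∃ e, Γ.head e = .inner v
  inner_not_sink : ∀ v, ∃ e, Γ.tail e = .inner v

/-- `rot` is the rotation system of an embedding in the cylinder.  The sources are numbered from
top to bottom, which is the clockwise order seen from the contracted left boundary; the sinks are
numbered from top to bottom, which is the counterclockwise order seen from the contracted right
boundary.  The embedding surface is a sphere by Euler's formula
`#vertices - #edges + #faces = 2 * #components`, the two contracted boundary circles
being vertices. -/
structure IsEmbedded [Fintype E] : Prop where
  rot_inner : ∀ d v, Γ.base d = .inner v → Γ.base (Γ.rot d) = .inner v
  rot_inner_cyclic : ∀ d d' v, Γ.base d = .inner v → Γ.base d' = .inner v → Γ.rot.SameCycle d d'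
  rot_source : ∀ d i, Γ.base d = .source i → Γ.base (Γ.rot d) = .source ((finRotate m).symm i)
  rot_sink : ∀ d j, Γ.base d = .sink j → Γ.base (Γ.rot d) = .sink (finRotate n j)
  planar : numCycles Γ.rot + numCycles Γ.faceRot = Fintype.card E + 2 * Γ.numComponents

/-- `Γ.IsDualWalk d l d'`: a curve that starts in the face on the left of `d`, crosses in turn the
half-edges in `l`, each from its left-hand to its right-hand side, and ends in the face on the
left of `d'`. -/
def IsDualWalk : E × Bool → List (E × Bool) → E × Bool → Prop
  | d, [], d' => Γ.faceRot.SameCycle d d'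
  | d, x :: l, d' => Γ.faceRot.SameCycle d x ∧ IsDualWalk (rev x) l d'

/-- The cut leads from the point of the left boundary just above the first source (that is, between
the last and the first source) to the point of the right boundary just above the first sink. -/
def IsCut : Prop :=
  ∀ (i : Fin m) (j : Fin n) (e f : E), i.val = 0 → j.val = 0 →
    Γ.tail e = .source i → Γ.head f = .sink j → Γ.IsDualWalk (e, true) Γ.cut (f, true)

/-- `Γ.IsPath a p b`: the list of edges `p` is a directed path from `a` to `b`. -/
def IsPath : NetVertex m n V → List E → NetVertex m n V → Prop
  | a, [], b => a = b
  | a, e :: p, b => Γ.tail e = a ∧ IsPath (Γ.head e) p b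

/-- There are no oriented cycles. -/
def IsAcyclic : Prop := ∀ a p, Γ.IsPath a p a → p = []

/-- An acyclic perfect cylindrical network with a cut, all sources on the left and all sinks on the
right boundary, numbered from top to bottom starting at the cut. -/
structure IsPerfectCylindrical [Fintype E] : Prop where
  perfect : Γ.IsPerfect
  embedded : Γ.IsEmbedded
  cut : Γ.IsCut
  acyclic : Γ.IsAcyclic

/-! ### The category of paths -/

/-- Generators: identities of the objects, edges, inverses of edges. -/
inductive Gen (m n : ℕ) (V E : Type*) where
  | one (a : NetVertex m n V)
  | edge (e : E)
  | inv (e : E)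

section Algebra

variable (k : Type*) [Field k]

open FreeAlgebra in
/-- The relations of the `k`-linear category generated by the free groupoid on `Γ`, written in the
algebra of all its morphisms (in which non-composable morphisms have product `0`); juxtaposition is
concatenation of paths. -/
inductive Rel [Fintype V] :
    FreeAlgebra k (Gen m n V E) → FreeAlgebra k (Gen m n V E) → Prop
  | one_mul_one (a : NetVertex m n V) : Rel (ι k (.one a) * ι k (.one a)) (ι k (.one a))
  | one_mul_one_of_ne (a b : NetVertex m n V) (h : a ≠ b) : Rel (ι k (.one a) * ι k (.one b)) 0
  | sum_one : Rel (∑ a, ι k (.one a)) 1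
  | one_mul_edge (e : E) : Rel (ι k (.one (Γ.tail e)) * ι k (.edge e)) (ι k (.edge e))
  | edge_mul_one (e : E) : Rel (ι k (.edge e) * ι k (.one (Γ.head e))) (ι k (.edge e))
  | one_mul_inv (e : E) : Rel (ι k (.one (Γ.head e)) * ι k (.inv e)) (ι k (.inv e))
  | inv_mul_one (e : E) : Rel (ι k (.inv e) * ι k (.one (Γ.tail e))) (ι k (.inv e))
  | edge_mul_inv (e : E) : Rel (ι k (.edge e) * ι k (.inv e)) (ι k (.one (Γ.tail e)))
  | inv_mul_edge (e : E) : Rel (ι k (.inv e) * ι k (.edge e)) (ι k (.one (Γ.head e)))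

variable [Fintype V]

/-- The algebra of morphisms of the `k`-linear category `𝒞 = k π₁(Σ, vertices of Γ)`, i.e. of the
free `k`-linear groupoid on `Γ`. -/
def PathAlg : Type _ := RingQuot (Γ.Rel k)

instance : Ring (Γ.PathAlg k) := inferInstanceAs (Ring (RingQuot (Γ.Rel k)))

instance : Algebra k (Γ.PathAlg k) := inferInstanceAs (Algebra k (RingQuot (Γ.Rel k)))

/-- The quotient map from the free algebra. -/
def toAlg : FreeAlgebra k (Gen m n V E) →ₐ[k] Γ.PathAlg k := RingQuot.mkAlgHom k (Γ.Rel k)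

/-- The identity morphism of the object `a`. -/
def idAt (a : NetVertex m n V) : Γ.PathAlg k :=
  Γ.toAlg k (FreeAlgebra.ι k (.one a))

/-- An edge as a morphism. -/
def arr (e : E) : Γ.PathAlg k :=
  Γ.toAlg k (FreeAlgebra.ι k (.edge e))

/-- The inverse of an edge as a morphism. -/
def arrInv (e : E) : Γ.PathAlg k :=
  Γ.toAlg k (FreeAlgebra.ι k (.inv e))

/-- `τ(f ⊗ g) = g ⊗ f`. -/
def tau : Γ.PathAlg k ⊗[k] Γ.PathAlg k →ₗ[k] Γ.PathAlg k ⊗[k] Γ.PathAlg k :=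
  (TensorProduct.comm k _ _).toLinearMap

open Classical in
/-- `∂_e` on generators, as the off-diagonal entry of a triangular matrix:
`∂_e f = δ_{e f} 1_{s(e)} ⊗ 1_{t(e)}` and `∂_e f⁻¹ = -δ_{e f} f⁻¹ ⊗ f⁻¹`. -/
def partialGen (e : E) :
    Gen m n V E → Matrix (Fin 2) (Fin 2) (Γ.PathAlg k ⊗[k] Γ.PathAlg k)
  | .one a => !![Γ.idAt k a ⊗ₜ 1, 0; 0, 1 ⊗ₜ Γ.idAt k a]
  | .edge f => !![Γ.arr k f ⊗ₜ 1,
      if f = e then Γ.idAt k (Γ.tail f) ⊗ₜ Γ.idAt k (Γ.head f) else 0; 0, 1 ⊗ₜ Γ.arr k f]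
  | .inv f => !![Γ.arrInv k f ⊗ₜ 1,
      if f = e then (-Γ.arrInv k f) ⊗ₜ Γ.arrInv k f else 0; 0, 1 ⊗ₜ Γ.arrInv k f]

variable {k} in
theorem toAlg_rel {x y : FreeAlgebra k (Gen m n V E)} (h : Γ.Rel k x y) :
    Γ.toAlg k x = Γ.toAlg k y :=
  RingQuot.mkAlgHom_rel k h

theorem partialGen_rel (e : E) ⦃x y : FreeAlgebra k (Gen m n V E)⦄ (h : Γ.Rel k x y) :
    FreeAlgebra.lift k (Γ.partialGen k e) x = FreeAlgebra.lift k (Γ.partialGen k e) y := by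
  have h₁ : ∀ a, Γ.idAt k a * Γ.idAt k a = Γ.idAt k a := fun a => by
    simpa only [map_mul, map_sum, map_zero, map_one, idAt] using Γ.toAlg_rel (.one_mul_one a)
  have h₂ : ∀ a b, a ≠ b → Γ.idAt k a * Γ.idAt k b = 0 := fun a b hab => by
    simpa only [map_mul, map_sum, map_zero, map_one, idAt] using Γ.toAlg_rel (.one_mul_one_of_ne a b hab)
  have h₃ : ∑ a, Γ.idAt k a = 1 := by
    simpa only [map_mul, map_sum, map_zero, map_one, idAt] using Γ.toAlg_rel .sum_one
  have h₄ : ∀ f, Γ.idAt k (Γ.tail f) * Γ.arr k f = Γ.arr k f := fun f => by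
    simpa only [map_mul, map_sum, map_zero, map_one, idAt, arr] using Γ.toAlg_rel (.one_mul_edge f)
  have h₅ : ∀ f, Γ.arr k f * Γ.idAt k (Γ.head f) = Γ.arr k f := fun f => by
    simpa only [map_mul, map_sum, map_zero, map_one, idAt, arr] using Γ.toAlg_rel (.edge_mul_one f)
  have h₆ : ∀ f, Γ.idAt k (Γ.head f) * Γ.arrInv k f = Γ.arrInv k f := fun f => by
    simpa only [map_mul, map_sum, map_zero, map_one, idAt, arrInv] using Γ.toAlg_rel (.one_mul_inv f)
  have h₇ : ∀ f, Γ.arrInv k f * Γ.idAt k (Γ.tail f) = Γ.arrInv k f := fun f => by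
    simpa only [map_mul, map_sum, map_zero, map_one, idAt, arrInv] using Γ.toAlg_rel (.inv_mul_one f)
  have h₈ : ∀ f, Γ.arr k f * Γ.arrInv k f = Γ.idAt k (Γ.tail f) := fun f => by
    simpa only [map_mul, map_sum, map_zero, map_one, idAt, arr, arrInv] using Γ.toAlg_rel (.edge_mul_inv f)
  have h₉ : ∀ f, Γ.arrInv k f * Γ.arr k f = Γ.idAt k (Γ.head f) := fun f => by
    simpa only [map_mul, map_sum, map_zero, map_one, idAt, arr, arrInv] using Γ.toAlg_rel (.inv_mul_edge f)
  have hone : (1 : Matrix (Fin 2) (Fin 2) (Γ.PathAlg k ⊗[k] Γ.PathAlg k)) =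
      !![1 ⊗ₜ 1, 0; 0, 1 ⊗ₜ 1] := by
    ext i j; fin_cases i <;> fin_cases j <;> simp [Algebra.TensorProduct.one_def]
  cases h with
  | one_mul_one a => simp [partialGen, h₁]
  | one_mul_one_of_ne a b hab =>
    simp only [map_mul, FreeAlgebra.lift_ι_apply, map_zero, partialGen, Matrix.mul_fin_two]
    ext i j; fin_cases i <;> fin_cases j <;> simp [h₂ a b hab]
  | sum_one =>
    simp only [map_sum, FreeAlgebra.lift_ι_apply, map_one, partialGen, hone]
    ext i j
    rw [Matrix.sum_apply]
    fin_cases i <;> fin_cases j <;>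
      simp [← TensorProduct.sum_tmul, ← TensorProduct.tmul_sum, h₃]
  | one_mul_edge f => by_cases hf : f = e <;> simp [partialGen, h₁, h₄, hf]
  | edge_mul_one f => by_cases hf : f = e <;> simp [partialGen, h₁, h₅, hf]
  | one_mul_inv f => by_cases hf : f = e <;> simp [partialGen, h₆, hf]
  | inv_mul_one f => by_cases hf : f = e <;> simp [partialGen, h₇, hf]
  | edge_mul_inv f =>
    by_cases hf : f = e <;> simp [partialGen, h₆, h₈, hf, TensorProduct.neg_tmul]
  | inv_mul_edge f =>
    by_cases hf : f = e <;> simp [partialGen, h₇, h₉, hf, TensorProduct.neg_tmul]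

/-- The algebra homomorphism `f ↦ !![f ⊗ 1, ∂_e f; 0, 1 ⊗ f]`; its multiplicativity is the Leibniz
rule `∂_e (f g) = (f ⊗ 1) ∂_e g + ∂_e f (1 ⊗ g)`. -/
def partialHom (e : E) :
    Γ.PathAlg k →ₐ[k] Matrix (Fin 2) (Fin 2) (Γ.PathAlg k ⊗[k] Γ.PathAlg k) :=
  RingQuot.liftAlgHom k ⟨FreeAlgebra.lift k (Γ.partialGen k e), Γ.partialGen_rel k e⟩

/-- The double derivation `∂_e = ∂/∂e`. -/
def partialD (e : E) : Γ.PathAlg k →ₗ[k] Γ.PathAlg k ⊗[k] Γ.PathAlg k :=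
  Matrix.entryLinearMap k (Γ.PathAlg k ⊗[k] Γ.PathAlg k) (0 : Fin 2) (1 : Fin 2) ∘ₗ
    (Γ.partialHom k e).toLinearMap

variable {k}

/-- `(x' ⊗ x'') ⊗ (y' ⊗ y'') ↦ (y' ⊗ x') c (x'' ⊗ y'')`. -/
def sandwich (c : Γ.PathAlg k ⊗[k] Γ.PathAlg k) :
    (Γ.PathAlg k ⊗[k] Γ.PathAlg k) ⊗[k] (Γ.PathAlg k ⊗[k] Γ.PathAlg k) →ₗ[k]
      Γ.PathAlg k ⊗[k] Γ.PathAlg k :=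
  LinearMap.mul' k (Γ.PathAlg k ⊗[k] Γ.PathAlg k) ∘ₗ
    TensorProduct.map (LinearMap.mulRight k c ∘ₗ Γ.tau k) LinearMap.id ∘ₗ
    (TensorProduct.tensorTensorTensorComm k (Γ.PathAlg k) (Γ.PathAlg k)
      (Γ.PathAlg k) (Γ.PathAlg k)).toLinearMap

end Algebra

/-- The edges at a white vertex `v` in counterclockwise order, the unique incoming one, `x₃`,
being last. -/
def IsWhite (v : V) (x₁ x₂ x₃ : E) : Prop :=
  Γ.head x₃ = .inner v ∧ Γ.rot (x₃, false) = (x₁, true) ∧ Γ.rot (x₁, true) = (x₂, true) ∧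
    Γ.rot (x₂, true) = (x₃, false)

/-- The edges at a black vertex `v` in counterclockwise order, the unique outgoing one, `y₃`,
being last. -/
def IsBlack (v : V) (y₁ y₂ y₃ : E) : Prop :=
  Γ.tail y₃ = .inner v ∧ Γ.rot (y₃, true) = (y₁, false) ∧ Γ.rot (y₁, false) = (y₂, false) ∧
    Γ.rot (y₂, false) = (y₃, true)

/-- The six parameters of the local brackets at white and black vertices. -/
structure Weights (k : Type*) where
  (w₁₂ w₁₃ w₂₃ b₁₂ b₁₃ b₂₃ : k)

/-- The parameters give the standard bracket, `W = 1/2` and `B = -1/2`, i.e. that of the twisted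
ribbon graph. -/
def Weights.IsStandard {k : Type*} [Field k] (w : Weights k) : Prop :=
  w.w₁₂ + w.w₁₃ - w.w₂₃ = 1 / 2 ∧ w.b₁₂ + w.b₁₃ - w.b₂₃ = -(1 / 2)

section Bracket

variable {k : Type*} [Field k] [Fintype V] [Fintype E] (w : Weights k)

open Classical in
/-- The skew-symmetric function of two edges with value `c` at `(a, b)`. -/
def pairTerm (a b : E) (c : Γ.PathAlg k ⊗[k] Γ.PathAlg k) (e f : E) :
    Γ.PathAlg k ⊗[k] Γ.PathAlg k :=
  (if e = a ∧ f = b then c else 0) - (if e = b ∧ f = a then Γ.tau k c else 0)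

open Classical in
/-- The double bracket of two edges, the sum of the contributions of the internal vertices. -/
def edgeBracket (e f : E) : Γ.PathAlg k ⊗[k] Γ.PathAlg k :=
  ∑ v : V, ∑ x₁ : E, ∑ x₂ : E, ∑ x₃ : E,
    ((if Γ.IsWhite v x₁ x₂ x₃ then
        Γ.pairTerm x₁ x₂ (w.w₁₂ • Γ.arr k x₁ ⊗ₜ Γ.arr k x₂) e f +
        Γ.pairTerm x₁ x₃ (w.w₁₃ • (Γ.arr k x₃ * Γ.arr k x₁) ⊗ₜ Γ.idAt k (.inner v)) e f +
        Γ.pairTerm x₂ x₃ (w.w₂₃ • (Γ.arr k x₃ * Γ.arr k x₂) ⊗ₜ Γ.idAt k (.inner v)) e f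
      else 0) +
     (if Γ.IsBlack v x₁ x₂ x₃ then
        Γ.pairTerm x₁ x₂ (w.b₁₂ • Γ.arr k x₂ ⊗ₜ Γ.arr k x₁) e f +
        Γ.pairTerm x₁ x₃ (w.b₁₃ • Γ.idAt k (.inner v) ⊗ₜ (Γ.arr k x₁ * Γ.arr k x₃)) e f +
        Γ.pairTerm x₂ x₃ (w.b₂₃ • Γ.idAt k (.inner v) ⊗ₜ (Γ.arr k x₂ * Γ.arr k x₃)) e f
      else 0))

/-- The double bracket on `𝒞`: the extension of `edgeBracket` by the double Leibniz identities,
`⟦x, y⟧ = ∑ (y' ⊗ x') ⟦e, f⟧ (x'' ⊗ y'')` over all edges `e`, `f`, where `∂_e x = x' ⊗ x''` and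
`∂_f y = y' ⊗ y''`. -/
def doubleBracket (x y : Γ.PathAlg k) : Γ.PathAlg k ⊗[k] Γ.PathAlg k :=
  ∑ e : E, ∑ f : E, Γ.sandwich (Γ.edgeBracket w e f) (Γ.partialD k e x ⊗ₜ Γ.partialD k f y)

end Bracket

/-! ### Boundary measurements -/

open Classical in
/-- The oriented intersection index of a path with the cut; a crossing from the right-hand to the
left-hand side of the cut counts `+1`. -/
def index (p : List E) : ℤ :=
  (p.map fun e => (Γ.cut.count (e, true) : ℤ) - (Γ.cut.count (e, false) : ℤ)).sum

section Measurement

variable {k : Type*} [Field k] [Fintype V]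

/-- The weight of a path: the product of its edges in `𝒞`. -/
def weight (p : List E) : Γ.PathAlg k := (p.map (Γ.arr k)).prod

/-- The boundary measurement matrix `B(z)`. -/
def boundaryMeasurement (z : k) : Matrix (Fin m) (Fin n) (Γ.PathAlg k) := fun i j =>
  ∑ᶠ p ∈ {p : List E | Γ.IsPath (.source i) p (.sink j)}, z ^ Γ.index p • Γ.weight p

end Measurement

theorem isPath_append {p q : List E} : ∀ {a b : NetVertex m n V},
    Γ.IsPath a (p ++ q) b → ∃ c, Γ.IsPath a p c ∧ Γ.IsPath c q b := by
  induction p with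
  | nil => intro a b h; exact ⟨a, rfl, h⟩
  | cons e p ih =>
    intro a b h
    obtain ⟨c, h₁, h₂⟩ := ih h.2
    exact ⟨c, ⟨h.1, h₁⟩, h₂⟩

theorem nodup_of_isPath (hΓ : Γ.IsAcyclic) {p : List E} :
    ∀ {a b : NetVertex m n V}, Γ.IsPath a p b → p.Nodup := by
  induction p with
  | nil => intro a b _; exact List.nodup_nil
  | cons e p ih =>
    intro a b h
    refine List.nodup_cons.2 ⟨fun he => ?_, ih h.2⟩
    obtain ⟨q, r, rfl⟩ := List.append_of_mem he
    obtain ⟨c, h₁, h₂⟩ := Γ.isPath_append h.2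
    have hc : Γ.tail e = c := h₂.1
    exact absurd (hΓ c (e :: q) ⟨hc, h₁⟩) (List.cons_ne_nil _ _)

/-- The sums defining the boundary measurements are finite. -/
theorem finite_isPath [Finite E] (hΓ : Γ.IsAcyclic) (a b : NetVertex m n V) :
    {p : List E | Γ.IsPath a p b}.Finite := by
  classical
  have := Fintype.ofFinite E
  exact (List.finite_length_le E (Fintype.card E)).subset
    fun p hp => (Γ.nodup_of_isPath hΓ hp).length_le_card

/-! ### Matrices over `𝒞` and over `𝒞 ⊗ 𝒞` -/

section MatrixOps

variable {k : Type*} [Field k] [Fintype V] {I J I' J' : Type*}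

/-- `⟦X, Y⟧ = ∑ ⟦x i j, y k l⟧ E i j ⊠ E k l`. -/
def matrixBracket [Fintype E] (w : Weights k) (X : Matrix I J (Γ.PathAlg k))
    (Y : Matrix I' J' (Γ.PathAlg k)) :
    Matrix (I × I') (J × J') (Γ.PathAlg k ⊗[k] Γ.PathAlg k) :=
  fun p q => Γ.doubleBracket w (X p.1 q.1) (Y p.2 q.2)

/-- `M_L`, with entries `m i j ⊗ 1`. -/
def leftMat (M : Matrix I J (Γ.PathAlg k)) : Matrix I J (Γ.PathAlg k ⊗[k] Γ.PathAlg k) :=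
  M.map fun x => x ⊗ₜ 1

/-- `M_R`, with entries `1 ⊗ m i j`. -/
def rightMat (M : Matrix I J (Γ.PathAlg k)) : Matrix I J (Γ.PathAlg k ⊗[k] Γ.PathAlg k) :=
  M.map fun x => 1 ⊗ₜ x

/-- A scalar matrix as a matrix over `𝒞 ⊗ 𝒞`. -/
def scalarMat (M : Matrix I J k) : Matrix I J (Γ.PathAlg k ⊗[k] Γ.PathAlg k) :=
  M.map (algebraMap k _)

/-- The entrywise transposition of tensor factors. -/
def tauMat (M : Matrix I J (Γ.PathAlg k ⊗[k] Γ.PathAlg k)) :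
    Matrix I J (Γ.PathAlg k ⊗[k] Γ.PathAlg k) :=
  M.map (Γ.tau k)

/-- The twisted commutator `[A, B]_τ = A B - (B A)^τ`. -/
def twistedCommutator [Fintype I] (A B : Matrix I I (Γ.PathAlg k ⊗[k] Γ.PathAlg k)) :
    Matrix I I (Γ.PathAlg k ⊗[k] Γ.PathAlg k) :=
  A * B - Γ.tauMat (B * A)

end MatrixOps

end CylNetwork

open scoped Kronecker in
/-- The trigonometric `r`-matrix for `GL(n)`. -/
def trigRMatrix {k : Type*} [Field k] (n : ℕ) (lam mu : k) :
    Matrix (Fin n × Fin n) (Fin n × Fin n) k :=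
  ((1 / 2) * ((mu + lam) / (mu - lam))) •
      ∑ a : Fin n, Matrix.single a a (1 : k) ⊗ₖ Matrix.single a a (1 : k) +
    (1 / (mu - lam)) •
      ∑ i : Fin n, ∑ j : Fin n, if i < j then
        lam • Matrix.single i j (1 : k) ⊗ₖ Matrix.single j i (1 : k) +
        mu • Matrix.single j i (1 : k) ⊗ₖ Matrix.single i j (1 : k)
      else 0

/-- The ground field `ℂ(λ, μ)`. -/
abbrev SpectralField : Type := FractionRing (MvPolynomial (Fin 2) ℂ)

/-- The spectral parameter `λ`. -/
def specLam : SpectralField := algebraMap (MvPolynomial (Fin 2) ℂ) SpectralField (MvPolynomial.X 0)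

/-- The spectral parameter `μ`. -/
def specMu : SpectralField := algebraMap (MvPolynomial (Fin 2) ℂ) SpectralField (MvPolynomial.X 1)

end

/-! By the double Leibniz rule the bracket of two path weights is a sum over edges at which both
paths are cut and their final parts exchanged. Hence `⟦b_{bj}(λ), b_{al}(μ)⟧` is a combination of
`wt(p) ⊗ wt(q)` with `p : a → j` and `q : b → l`. At each vertex the six weights enter only through
`w₁₂ + w₁₃ - w₂₃` or `b₁₂ + b₁₃ - b₂₃` (`white_bracket`, `black_bracket`). A pair `(p, q)` receives
a contribution only from the vertices where `p` and `q` separate (white) or join (black), equal to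
`±½ λ^{d(p)-h} μ^{d(q)+h}`, where `h` is the difference of the indices of the parts of `p` and `q`
up to that vertex (`doubleBracket_eq_sum`).

It remains to add up these contributions for fixed `p` and `q` (`sum_localTerms`). Once each
boundary circle is contracted to a point, `p - q` is a cycle on a sphere, hence the jump of a
function `u` on the faces (`exists_facePotential`). Measure `u` downwards from the face where the
cut starts. On an edge common to `p` and `q` this level is exactly `h`; that is
`IsPotential.sub_eq_index_of_shared`, the place where acyclicity and the cut meet planarity. On an
edge of `p` alone, the mean level of its two sides is a half-integer. The function `halfStep` has
the local contributions as its differences over steps of one half, so the sum telescopes along `p`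
to the value on its first edge minus the value on its last edge.

At the sources the level depends only on the order of `a` and `b`, which yields the coefficient of
`r_m`. At the sinks it depends on the order of `j` and `l`, shifted by `d(p) - d(q)`; the shift
exchanges `λ` and `μ` in the monomial and yields the term with `r_n`. -/

namespace CylNetwork

variable {m n : ℕ} {V E : Type*}

/-! ### Face potentials of cycles, from Euler's formula. -/

/-- The discrete gradient on functions on the cycles of a permutation of the half-edges. -/
noncomputable def gradient (σ : Equiv.Perm (E × Bool)) :
    (Quotient (Equiv.Perm.SameCycle.setoid σ) → ℚ) →ₗ[ℚ] (E → ℚ) where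
  toFun x e := x (Quotient.mk _ (e, true)) - x (Quotient.mk _ (e, false))
  map_add' x y := by ext e; simp only [Pi.add_apply]; ring
  map_smul' c x := by ext e; simp only [Pi.smul_apply, smul_eq_mul, RingHom.id_apply]; ring

/-- A function with zero gradient is invariant under `σ` and under `rev`, hence constant on the
orbits of the group they generate. The subgroup `H` is left free so that the orbits counted by
`numComponents` serve for both `rot` and `faceRot`. -/
theorem finrank_ker_gradient_le [Finite E] (σ : Equiv.Perm (E × Bool))
    (H : Subgroup (Equiv.Perm (E × Bool))) (hH : H ≤ Subgroup.closure {σ, rev}) :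
    Module.finrank ℚ (LinearMap.ker (gradient σ)) ≤
      Nat.card (MulAction.orbitRel.Quotient H (E × Bool)) := by
  classical
  have := Fintype.ofFinite (MulAction.orbitRel.Quotient H (E × Bool))
  let Ψ : (MulAction.orbitRel.Quotient H (E × Bool) → ℚ) →ₗ[ℚ]
      (Quotient (Equiv.Perm.SameCycle.setoid σ) → ℚ) :=
    LinearMap.funLeft ℚ ℚ fun q => Quotient.mk _ q.out
  have hle : LinearMap.ker (gradient σ) ≤ LinearMap.range Ψ := by
    intro x hx
    have hrev : ∀ d, x (Quotient.mk _ (rev d)) = x (Quotient.mk _ d) := by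
      rintro ⟨e, b⟩
      have h := congrFun (LinearMap.mem_ker.1 hx) e
      have h' : x (Quotient.mk _ (e, true)) = x (Quotient.mk _ (e, false)) := sub_eq_zero.1 h
      cases b
      · exact h'
      · exact h'.symm
    have hσ : ∀ d, x (Quotient.mk _ (σ d)) = x (Quotient.mk _ d) := fun d =>
      congrArg x (Quotient.sound (Equiv.Perm.sameCycle_apply_left.2 (Equiv.Perm.SameCycle.refl σ d)))
    have hcl : ∀ g ∈ Subgroup.closure {σ, rev}, ∀ d,
        x (Quotient.mk _ (g d)) = x (Quotient.mk _ d) := by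
      intro g hg
      induction hg using Subgroup.closure_induction with
      | mem g hg =>
        rcases hg with rfl | rfl
        · exact hσ
        · exact hrev
      | one => intro d; rfl
      | mul a b _ _ ha hb => intro d; rw [Equiv.Perm.mul_apply, ha, hb]
      | inv a _ ha => intro d; rw [← ha, ← Equiv.Perm.mul_apply, mul_inv_cancel, Equiv.Perm.one_apply]
    refine ⟨fun o => x (Quotient.mk _ o.out), ?_⟩
    ext q
    change x (Quotient.mk _ (Quotient.mk _ q.out : MulAction.orbitRel.Quotient H (E × Bool)).out) = x q
    obtain ⟨g, hg⟩ := (MulAction.orbitRel_apply.1 (Quotient.mk_out (s := MulAction.orbitRel H (E × Bool)) q.out))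
    have hg' : (g : Equiv.Perm (E × Bool)) q.out =
      (Quotient.mk _ q.out : MulAction.orbitRel.Quotient H (E × Bool)).out := hg
    rw [← hg', hcl _ (hH g.2), Quotient.out_eq]
  calc _ ≤ Module.finrank ℚ (LinearMap.range Ψ) := Submodule.finrank_mono hle
    _ ≤ Module.finrank ℚ (MulAction.orbitRel.Quotient H (E × Bool) → ℚ) :=
      LinearMap.finrank_range_le Ψ
    _ = _ := by rw [Module.finrank_fintype_fun_eq_card, Nat.card_eq_fintype_card]

theorem numCycles_le_finrank_range_gradient [Finite E] (σ : Equiv.Perm (E × Bool))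
    (H : Subgroup (Equiv.Perm (E × Bool))) (hH : H ≤ Subgroup.closure {σ, rev}) :
    numCycles σ ≤ Module.finrank ℚ (LinearMap.range (gradient σ)) +
      Nat.card (MulAction.orbitRel.Quotient H (E × Bool)) := by
  classical
  have := Fintype.ofFinite (Quotient (Equiv.Perm.SameCycle.setoid σ))
  have h := LinearMap.finrank_range_add_finrank_ker (gradient σ)
  rw [Module.finrank_fintype_fun_eq_card, ← Nat.card_eq_fintype_card] at h
  have := finrank_ker_gradient_le σ H hH
  unfold numCycles
  omega

variable (Γ : CylNetwork m n V E)

theorem rev_rev (d : E × Bool) : rev (rev d) = d := by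
  obtain ⟨e, b⟩ := d
  exact congrArg (Prod.mk e) (Bool.not_not b)

/-- The half-edge `rev (rot d)` is the predecessor of `d` on its face: the corner between `d` and
`rot d` lies to the left of `d` and to the right of `rot d`. -/
theorem apply_rev_of_faceRot_invariant {u : E × Bool → ℚ} (hu : ∀ d, u (Γ.faceRot d) = u d)
    (d : E × Bool) : u (rev (Γ.rot d)) = u d := by
  rw [← hu (rev (Γ.rot d))]
  congr 1
  simp [faceRot, rev_rev]

/-- Gradients of functions on the vertices are orthogonal to gradients of functions on the
faces. -/
theorem sum_gradient_mul_gradient [Fintype E] {u x : E × Bool → ℚ}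
    (hu : ∀ d, u (Γ.faceRot d) = u d) (hx : ∀ d, x (Γ.rot d) = x d) :
    ∑ e, (u (e, true) - u (e, false)) * (x (e, true) - x (e, false)) = 0 := by
  -- Reindexing by `rot` identifies the two sums; their difference, grouped by edges, is minus the
  -- sum in question.
  have h₁ : ∑ d, u (rev d) * x d = ∑ d, u d * x d := by
    rw [← Equiv.sum_comp Γ.rot]
    exact Finset.sum_congr rfl fun d _ => by
      rw [Γ.apply_rev_of_faceRot_invariant hu, hx]
  rw [Fintype.sum_prod_type, Fintype.sum_prod_type, ← sub_eq_zero, ← Finset.sum_sub_distrib] at h₁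
  rw [← neg_eq_zero, ← Finset.sum_neg_distrib, ← h₁]
  refine Finset.sum_congr rfl fun e _ => ?_
  simp only [Fintype.sum_bool, rev, Equiv.prodCongr_apply, Prod.map, Equiv.refl_apply,
    Equiv.boolNot_apply, Bool.not_true, Bool.not_false]
  ring

/-- Every cycle on a sphere bounds. Gradients from vertices and from faces are orthogonal, so their
ranges meet in zero. The rank bounds and Euler's formula make the dimensions add up to the number of
edges, so the two ranges span everything. A cycle, being orthogonal to vertex gradients, has no
component among them. -/
theorem exists_facePotential [Fintype E]
    (planar : numCycles Γ.rot + numCycles Γ.faceRot = Fintype.card E + 2 * Γ.numComponents)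
    {φ : E → ℚ}
    (hφ : ∀ x : E × Bool → ℚ, (∀ d, x (Γ.rot d) = x d) →
      ∑ e, φ e * (x (e, true) - x (e, false)) = 0) :
    ∃ u : E × Bool → ℚ, (∀ d, u (Γ.faceRot d) = u d) ∧
      ∀ e, u (e, true) - u (e, false) = φ e := by
  classical
  have inv (σ : Equiv.Perm (E × Bool)) (x : Quotient (Equiv.Perm.SameCycle.setoid σ) → ℚ)
      (d : E × Bool) : x (Quotient.mk _ (σ d)) = x (Quotient.mk _ d) :=
    congrArg x (Quotient.sound (Equiv.Perm.sameCycle_apply_left.2 (Equiv.Perm.SameCycle.refl σ d)))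
  have hV := numCycles_le_finrank_range_gradient Γ.rot (Subgroup.closure {Γ.rot, rev}) le_rfl
  have hF := numCycles_le_finrank_range_gradient Γ.faceRot (Subgroup.closure {Γ.rot, rev}) (by
    rw [Subgroup.closure_le]
    have h₁ : rev ∈ Subgroup.closure {Γ.faceRot, (rev : Equiv.Perm (E × Bool))} :=
      Subgroup.subset_closure (by simp)
    have h₂ : Γ.faceRot ∈ Subgroup.closure {Γ.faceRot, (rev : Equiv.Perm (E × Bool))} :=
      Subgroup.subset_closure (by simp)
    rintro g (rfl | rfl)
    · have : Γ.rot = rev * Γ.faceRot⁻¹ := by simp [faceRot]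
      rw [this]
      exact mul_mem h₁ (inv_mem h₂)
    · exact h₁)
  change numCycles Γ.rot ≤ _ + Γ.numComponents at hV
  change numCycles Γ.faceRot ≤ _ + Γ.numComponents at hF
  have hinf : LinearMap.range (gradient Γ.rot) ⊓ LinearMap.range (gradient Γ.faceRot) = ⊥ := by
    rw [eq_bot_iff]
    rintro y ⟨⟨x, hx⟩, ⟨u, hu⟩⟩
    have h := Γ.sum_gradient_mul_gradient (u := fun d => u (Quotient.mk _ d))
      (x := fun d => x (Quotient.mk _ d)) (inv _ u) (inv _ x)
    have h' : ∑ e, y e * y e = 0 := by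
      rw [← h]
      exact Finset.sum_congr rfl fun e _ =>
        congrArg₂ (· * ·) (congrFun hu e).symm (congrFun hx e).symm
    rw [Finset.sum_eq_zero_iff_of_nonneg (fun e _ => mul_self_nonneg _)] at h'
    exact (Submodule.mem_bot ℚ).2 (funext fun e => mul_self_eq_zero.1 (h' e (Finset.mem_univ e)))
  have htop : LinearMap.range (gradient Γ.rot) ⊔ LinearMap.range (gradient Γ.faceRot) = ⊤ := by
    apply Submodule.eq_top_of_finrank_eq
    have h := Submodule.finrank_sup_add_finrank_inf_eq
      (LinearMap.range (gradient Γ.rot)) (LinearMap.range (gradient Γ.faceRot))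
    rw [hinf, finrank_bot] at h
    refine le_antisymm (Submodule.finrank_le _) ?_
    rw [Module.finrank_fintype_fun_eq_card]
    omega
  obtain ⟨a, ⟨x, rfl⟩, b, ⟨u, rfl⟩, hab⟩ :=
    Submodule.mem_sup.1 (htop ▸ Submodule.mem_top : φ ∈ LinearMap.range (gradient Γ.rot) ⊔
      LinearMap.range (gradient Γ.faceRot))
  -- The vertex component is orthogonal to `φ` and to the face component, hence to itself.
  have ha : gradient Γ.rot x = 0 := by
    have h := hφ (fun d => x (Quotient.mk _ d)) (inv _ x)
    have h₂ := Γ.sum_gradient_mul_gradient (u := fun d => u (Quotient.mk _ d))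
      (x := fun d => x (Quotient.mk _ d)) (inv _ u) (inv _ x)
    have h₃ : ∑ e, gradient Γ.rot x e * gradient Γ.rot x e = 0 := by
      have : ∀ e, gradient Γ.rot x e * gradient Γ.rot x e =
          φ e * gradient Γ.rot x e - gradient Γ.faceRot u e * gradient Γ.rot x e := fun e => by
        rw [← hab, Pi.add_apply]; ring
      rw [Finset.sum_congr rfl fun e _ => this e, Finset.sum_sub_distrib]
      exact (congrArg₂ _ h h₂).trans (sub_zero _)
    rw [Finset.sum_eq_zero_iff_of_nonneg (fun e _ => mul_self_nonneg _)] at h₃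
    exact funext fun e => mul_self_eq_zero.1 (h₃ e (Finset.mem_univ e))
  refine ⟨fun d => u (Quotient.mk _ d), inv _ u, fun e => ?_⟩
  rw [← hab, ha, zero_add]
  rfl

end CylNetwork

namespace CylNetwork

theorem eq_of_sameCycle {D : Type*} [Finite D] {σ : Equiv.Perm D} {f : D → ℚ} (S : D → Prop)
    (hS : ∀ d, S d → S (σ d)) (hf : ∀ d, S d → f (σ d) = f d) {d d' : D}
    (h : σ.SameCycle d d') (hd : S d) : f d' = f d := by
  obtain ⟨N, -, -, rfl⟩ := h.exists_pow_eq'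
  have key : ∀ N : ℕ, S ((σ ^ N) d) ∧ f ((σ ^ N) d) = f d := by
    intro N
    induction N with
    | zero => exact ⟨hd, rfl⟩
    | succ N ih =>
      rw [pow_succ', Equiv.Perm.mul_apply]
      exact ⟨hS _ ih.1, (hf _ ih.1).trans ih.2⟩
  exact (key N).2

variable {m n : ℕ} {V E : Type*} {Γ : CylNetwork m n V E}

/-! ### Paths -/

theorem IsPath.append {p q : List E} : ∀ {a b c : NetVertex m n V},
    Γ.IsPath a p b → Γ.IsPath b q c → Γ.IsPath a (p ++ q) c := by
  induction p with
  | nil => rintro a b c rfl h; exact h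
  | cons e p ih => exact fun h₁ h₂ => ⟨h₁.1, ih h₁.2 h₂⟩

theorem isPath_append_cons {p q : List E} {e : E} {a b : NetVertex m n V} :
    Γ.IsPath a (p ++ e :: q) b ↔ Γ.IsPath a p (Γ.tail e) ∧ Γ.IsPath (Γ.head e) q b := by
  constructor
  · intro h
    obtain ⟨c, h₁, h₂, h₃⟩ := Γ.isPath_append h
    exact ⟨h₂ ▸ h₁, h₃⟩
  · exact fun h => h.1.append ⟨rfl, h.2⟩

theorem isPath_singleton (e : E) : Γ.IsPath (Γ.tail e) [e] (Γ.head e) := ⟨rfl, rfl⟩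

theorem IsPath.of_mem {p : List E} {a b : NetVertex m n V} (h : Γ.IsPath a p b) {e : E}
    (he : e ∈ p) : (∃ q, Γ.IsPath a q (Γ.tail e)) ∧ ∃ q, Γ.IsPath (Γ.head e) q b := by
  obtain ⟨q, r, rfl⟩ := List.append_of_mem he
  exact ⟨⟨q, (isPath_append_cons.1 h).1⟩, ⟨r, (isPath_append_cons.1 h).2⟩⟩

theorem IsPath.eq_nil_of_source (hΓ : Γ.IsPerfect) {p : List E} {a : NetVertex m n V}
    {i : Fin m} (h : Γ.IsPath a p (.source i)) : p = [] := by
  rcases List.eq_nil_or_concat p with rfl | ⟨q, e, rfl⟩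
  · rfl
  · rw [List.concat_eq_append] at h
    exact absurd (isPath_append_cons.1 h).2 (hΓ.source_out i e)

theorem IsPath.eq_nil_of_sink (hΓ : Γ.IsPerfect) {p : List E} {b : NetVertex m n V}
    {j : Fin n} (h : Γ.IsPath (.sink j) p b) : p = [] := by
  cases p with
  | nil => rfl
  | cons e p => exact absurd h.1 (hΓ.sink_in j e)

theorem not_isPath_head_tail (hΓ : Γ.IsAcyclic) {e : E} {p : List E} :
    ¬ Γ.IsPath (Γ.head e) p (Γ.tail e) :=
  fun h => List.cons_ne_nil e p (hΓ _ _ (show Γ.IsPath (Γ.tail e) (e :: p) (Γ.tail e) from ⟨rfl, h⟩))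

theorem index_nil : Γ.index [] = 0 := rfl

theorem index_append (p q : List E) : Γ.index (p ++ q) = Γ.index p + Γ.index q := by
  simp [index]

theorem index_cons (e : E) (p : List E) : Γ.index (e :: p) = Γ.index [e] + Γ.index p := by
  simp [index]

/-! ### Vertices and half-edges -/

theorem exists_unique_sourceEdge (hΓ : Γ.IsPerfect) (i : Fin m) :
    ∃ e, Γ.tail e = .source i ∧ (∀ d, Γ.base d = .source i → d = (e, true)) := by
  obtain ⟨⟨e, b⟩, hd, hu⟩ := hΓ.source_univalent i
  cases b with
  | true => exact ⟨e, hd, hu⟩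
  | false => exact absurd hd (hΓ.source_out i e)

theorem exists_unique_sinkEdge (hΓ : Γ.IsPerfect) (j : Fin n) :
    ∃ e, Γ.head e = .sink j ∧ (∀ d, Γ.base d = .sink j → d = (e, false)) := by
  obtain ⟨⟨e, b⟩, hd, hu⟩ := hΓ.sink_univalent j
  cases b with
  | false => exact ⟨e, hd, hu⟩
  | true => exact absurd hd (hΓ.sink_in j e)

theorem finRotate_eq_of_val {N : ℕ} {i j : Fin N} (h : j.val = i.val + 1) : finRotate N i = j := by
  cases N with
  | zero => exact i.elim0
  | succ N =>
    ext
    rw [coe_finRotate_of_ne_last, h]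
    rintro rfl
    have := j.2
    simp at h
    omega

/-- Invariance is asked only at the sources, so that the lemma applies also to face potentials,
which jump elsewhere. Rotation steps from source `i` to source `i - 1`, down to source `0`. -/
theorem eq_of_base_source [Fintype E] (hΓ : Γ.IsPerfect) (hE : Γ.IsEmbedded) {f : E × Bool → ℚ}
    (hf : ∀ d i, Γ.base d = .source i → f (Γ.rot d) = f d) {d d' : E × Bool} {i i' : Fin m}
    (hd : Γ.base d = .source i) (hd' : Γ.base d' = .source i') : f d = f d' := by
  have hm : 0 < m := i.pos
  have key : ∀ (N : ℕ) (i : Fin m), i.val = N → ∀ d d₀, Γ.base d = .source i →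
      Γ.base d₀ = .source ⟨0, hm⟩ → f d = f d₀ := by
    intro N
    induction N with
    | zero =>
      rintro ⟨_, _⟩ rfl d d₀ hd hd₀
      rw [(hΓ.source_univalent _).unique hd hd₀]
    | succ N ih =>
      intro i hi d d₀ hd hd₀
      rw [← hf d i hd]
      have hN : N < m := by have := i.2; omega
      refine ih ⟨N, hN⟩ rfl _ _ ?_ hd₀
      rw [hE.rot_source d i hd, ← finRotate_eq_of_val (i := ⟨N, hN⟩) (j := i) hi,
        Equiv.symm_apply_apply]
  obtain ⟨d₀, hd₀, -⟩ := hΓ.source_univalent ⟨0, hm⟩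
  rw [key _ i rfl d d₀ hd hd₀, key _ i' rfl d' d₀ hd' hd₀]

theorem eq_of_base_sink [Fintype E] (hΓ : Γ.IsPerfect) (hE : Γ.IsEmbedded) {f : E × Bool → ℚ}
    (hf : ∀ d j, Γ.base d = .sink j → f (Γ.rot d) = f d) {d d' : E × Bool} {j j' : Fin n}
    (hd : Γ.base d = .sink j) (hd' : Γ.base d' = .sink j') : f d = f d' := by
  have hn : 0 < n := j.pos
  have key : ∀ (N : ℕ) (j : Fin n), j.val = N → ∀ d d₀, Γ.base d = .sink j →
      Γ.base d₀ = .sink ⟨0, hn⟩ → f d = f d₀ := by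
    intro N
    induction N with
    | zero =>
      rintro ⟨_, _⟩ rfl d d₀ hd hd₀
      rw [(hΓ.sink_univalent _).unique hd hd₀]
    | succ N ih =>
      intro j hj d d₀ hd hd₀
      have hN : N < n := by have := j.2; omega
      obtain ⟨d₁, hd₁, -⟩ := hΓ.sink_univalent ⟨N, hN⟩
      have h := hE.rot_sink d₁ _ hd₁
      rw [finRotate_eq_of_val (j := j) hj] at h
      rw [(hΓ.sink_univalent _).unique hd h, hf d₁ _ hd₁, ih ⟨N, hN⟩ rfl _ _ hd₁ hd₀]
  obtain ⟨d₀, hd₀, -⟩ := hΓ.sink_univalent ⟨0, hn⟩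
  rw [key _ j rfl d d₀ hd hd₀, key _ j' rfl d' d₀ hd' hd₀]

theorem eq_of_base_eq [Fintype E] (hΓ : Γ.IsPerfect) (hE : Γ.IsEmbedded) {f : E × Bool → ℚ}
    {a : NetVertex m n V} (hf : ∀ d, Γ.base d = a → Γ.base (Γ.rot d) = a → f (Γ.rot d) = f d)
    {d d' : E × Bool} (hd : Γ.base d = a) (hd' : Γ.base d' = a) : f d = f d' := by
  cases a with
  | source i => rw [(hΓ.source_univalent i).unique hd hd']
  | sink j => rw [(hΓ.sink_univalent j).unique hd hd']
  | inner v =>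
    exact eq_of_sameCycle (fun d => Γ.base d = .inner v) (fun d h => hE.rot_inner d v h)
      (fun d h => hf d h (hE.rot_inner d v h)) (hE.rot_inner_cyclic d' d v hd' hd) hd'

/-- A function on half-edges invariant under rotation is a function on the vertices, the sources
being identified with each other, and also the sinks. -/
theorem exists_vertexFunction [Fintype E] (hΓ : Γ.IsPerfect) (hE : Γ.IsEmbedded)
    {x : E × Bool → ℚ} (hx : ∀ d, x (Γ.rot d) = x d) :
    ∃ X : NetVertex m n V → ℚ, (∀ d, x d = X (Γ.base d)) ∧
      (∀ i i', X (.source i) = X (.source i')) ∧ ∀ j j', X (.sink j) = X (.sink j') := by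
  classical
  let X : NetVertex m n V → ℚ := fun a => if h : ∃ d, Γ.base d = a then x h.choose else 0
  have hX : ∀ d, x d = X (Γ.base d) := fun d => by
    have h : ∃ d', Γ.base d' = Γ.base d := ⟨d, rfl⟩
    simp only [X, dif_pos h]
    exact eq_of_base_eq hΓ hE (fun d _ _ => hx d) rfl h.choose_spec
  refine ⟨X, hX, fun i i' => ?_, fun j j' => ?_⟩
  · obtain ⟨d, hd, -⟩ := hΓ.source_univalent i
    obtain ⟨d', hd', -⟩ := hΓ.source_univalent i'
    rw [← hd, ← hd', ← hX, ← hX]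
    exact eq_of_base_source hΓ hE (fun d _ _ => hx d) hd hd'
  · obtain ⟨d, hd, -⟩ := hΓ.sink_univalent j
    obtain ⟨d', hd', -⟩ := hΓ.sink_univalent j'
    rw [← hd, ← hd', ← hX, ← hX]
    exact eq_of_base_sink hΓ hE (fun d _ _ => hx d) hd hd'

/-! ### Potentials of differences of paths -/

open Classical in
/-- The difference of two paths, as a function on the edges. -/
noncomputable def pathDiff (p q : List E) (e : E) : ℚ := p.count e - q.count e

theorem sum_count_mul [Fintype E] [DecidableEq E] (p : List E) (y : E → ℚ) :
    ∑ e, (p.count e : ℚ) * y e = (p.map y).sum := by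
  induction p with
  | nil => simp
  | cons a p ih =>
    simp only [List.count_cons, Nat.cast_add, add_mul, Finset.sum_add_distrib, ih, List.map_cons,
      List.sum_cons, Nat.cast_ite, beq_iff_eq, ite_mul, Nat.cast_one, Nat.cast_zero, one_mul,
      zero_mul, Finset.sum_ite_eq, Finset.mem_univ, if_true]
    ring

theorem sum_pathDiff_mul [Fintype E] (p q : List E) (y : E → ℚ) :
    ∑ e, pathDiff p q e * y e = (p.map y).sum - (q.map y).sum := by
  classical
  rw [← sum_count_mul, ← sum_count_mul, ← Finset.sum_sub_distrib]
  exact Finset.sum_congr rfl fun e _ => by unfold pathDiff; rw [sub_mul]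

theorem pathDiff_ne_zero {p q : List E} {e : E} (h : pathDiff p q e ≠ 0) : e ∈ p ∨ e ∈ q := by
  classical
  by_contra! hc
  apply h
  unfold pathDiff
  rw [List.count_eq_zero_of_not_mem hc.1, List.count_eq_zero_of_not_mem hc.2, sub_self]

theorem pathDiff_of_nodup {p q : List E} (hp : p.Nodup) (hq : q.Nodup) (e : E)
    [Decidable (e ∈ p)] [Decidable (e ∈ q)] :
    pathDiff p q e = (if e ∈ p then 1 else 0) - (if e ∈ q then 1 else 0) := by
  classical
  unfold pathDiff
  rw [List.Nodup.count hp, List.Nodup.count hq]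
  push_cast
  congr!

variable (Γ) in
/-- `u` is a function on the faces which drops by `φ e` when the edge `e` is crossed from left to
right. -/
structure IsPotential (u : E × Bool → ℚ) (φ : E → ℚ) : Prop where
  faceRot (d : E × Bool) : u (Γ.faceRot d) = u d
  sub_eq (e : E) : u (e, true) - u (e, false) = φ e

theorem sum_path_telescope (X : NetVertex m n V → ℚ) {p : List E} : ∀ {a b : NetVertex m n V},
    Γ.IsPath a p b → (p.map fun e => X (Γ.tail e) - X (Γ.head e)).sum = X a - X b := by
  induction p with
  | nil => rintro a b rfl; simp
  | cons e p ih =>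
    rintro a b ⟨rfl, h⟩
    rw [List.map_cons, List.sum_cons, ih h]
    ring

/-- The hypothesis `h` says that `p` and `q` have the same boundary after the sources, and likewise
the sinks, are identified: `p - q` is then a cycle, since its pairing with a vertex gradient
telescopes. -/
theorem exists_isPotential_pathDiff [Fintype E] (hΓ : Γ.IsPerfect) (hE : Γ.IsEmbedded)
    {p q : List E} {a b a' b' : NetVertex m n V} (hp : Γ.IsPath a p b) (hq : Γ.IsPath a' q b')
    (h : ∀ X : NetVertex m n V → ℚ, (∀ i i', X (.source i) = X (.source i')) →
      (∀ j j', X (.sink j) = X (.sink j')) → X a - X b = X a' - X b') :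
    ∃ u, Γ.IsPotential u (pathDiff p q) := by
  obtain ⟨u, h₁, h₂⟩ := Γ.exists_facePotential hE.planar (φ := pathDiff p q) (by
    intro x hx
    obtain ⟨X, hX, hs, ht⟩ := exists_vertexFunction hΓ hE hx
    have : ∀ e, x (e, true) - x (e, false) = X (Γ.tail e) - X (Γ.head e) := fun e => by
      rw [hX, hX]; rfl
    simp only [this]
    rw [sum_pathDiff_mul, sum_path_telescope X hp, sum_path_telescope X hq, h X hs ht, sub_self])
  exact ⟨u, h₁, h₂⟩

namespace IsPotential

variable {u : E × Bool → ℚ} {φ : E → ℚ} (hu : Γ.IsPotential u φ)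
include hu

theorem rev_rot (d : E × Bool) : u (rev (Γ.rot d)) = u d :=
  Γ.apply_rev_of_faceRot_invariant hu.faceRot d

theorem rev_eq_of_eq_zero {d : E × Bool} (h : φ d.1 = 0) : u (rev d) = u d := by
  obtain ⟨e, b⟩ := d
  have := hu.sub_eq e
  rw [h, sub_eq_zero] at this
  cases b
  · exact this
  · exact this.symm

theorem rot_eq_of_eq_zero {d : E × Bool} (h : φ (Γ.rot d).1 = 0) : u (Γ.rot d) = u d := by
  rw [← hu.rev_rot d, hu.rev_eq_of_eq_zero h]

theorem sub {u' : E × Bool → ℚ} {φ' : E → ℚ} (hu' : Γ.IsPotential u' φ') :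
    Γ.IsPotential (u - u') (φ - φ') where
  faceRot d := by simp only [Pi.sub_apply, hu.faceRot, hu'.faceRot]
  sub_eq e := by simp only [Pi.sub_apply, ← hu.sub_eq, ← hu'.sub_eq]; ring

/-- No edge attached to a vertex of the path makes `u` jump, so `u` does not change while one turns
around these vertices and moves along the path. The condition ranges over all vertices lying between
`a` and `b`, a form that acyclicity can verify. -/
theorem eq_of_path [Fintype E] (hΓ : Γ.IsPerfect) (hE : Γ.IsEmbedded) {p : List E} :
    ∀ {a b : NetVertex m n V}, Γ.IsPath a p b →
    (∀ c d, (∃ q, Γ.IsPath a q c) → (∃ q, Γ.IsPath c q b) → Γ.base d = c → φ d.1 = 0) →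
    ∀ {d d' : E × Bool}, Γ.base d = a → Γ.base d' = b → u d = u d' := by
  have hv : ∀ {c : NetVertex m n V}, (∀ d, Γ.base d = c → φ d.1 = 0) → ∀ {d d' : E × Bool},
      Γ.base d = c → Γ.base d' = c → u d = u d' := fun h _ _ hd hd' =>
    eq_of_base_eq hΓ hE (fun d _ h' => hu.rot_eq_of_eq_zero (h _ h')) hd hd'
  induction p with
  | nil =>
    rintro a b rfl h d d' hd hd'
    exact hv (fun d hd => h a d ⟨[], rfl⟩ ⟨[], rfl⟩ hd) hd hd'
  | cons e p ih =>
    rintro a b ⟨rfl, hp⟩ h d d' hd hd'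
    have h₀ := fun d hd => h (Γ.tail e) d ⟨[], rfl⟩ ⟨e :: p, rfl, hp⟩ hd
    have h₁ : u d = u (e, true) := hv h₀ hd rfl
    rw [h₁, ← hu.rev_eq_of_eq_zero (h₀ (e, true) rfl)]
    exact ih hp (fun c d ⟨q, hq⟩ h₂ h₃ => h c d ⟨e :: q, rfl, hq⟩ h₂ h₃) rfl hd'

theorem sub_of_isDualWalk [Finite E] {l : List (E × Bool)} : ∀ {d d' : E × Bool},
    Γ.IsDualWalk d l d' → u d - u d' = (l.map fun x => u x - u (rev x)).sum := by
  have hs : ∀ {d d' : E × Bool}, Γ.faceRot.SameCycle d d' → u d' = u d := fun h =>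
    eq_of_sameCycle (fun _ => True) (fun _ _ => trivial) (fun d _ => hu.faceRot d) h trivial
  induction l with
  | nil => intro d d' h; simp [hs h]
  | cons x l ih =>
    rintro d d' ⟨h₁, h₂⟩
    rw [List.map_cons, List.sum_cons, ← ih h₂, hs h₁]
    ring

open Classical in
theorem sum_cut [Fintype E] (l : List (E × Bool)) : (l.map fun x => u x - u (rev x)).sum =
    ∑ e, φ e * (((l.count (e, true) : ℤ) - (l.count (e, false) : ℤ) : ℤ) : ℚ) := by
  induction l with
  | nil => simp
  | cons x l ih =>
    obtain ⟨a, b⟩ := x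
    have : ∀ e, φ e * (((((a, b) :: l).count (e, true) : ℤ) -
        (((a, b) :: l).count (e, false) : ℤ) : ℤ) : ℚ) =
        φ e * (((l.count (e, true) : ℤ) - (l.count (e, false) : ℤ) : ℤ) : ℚ) +
        if a = e then (if b then φ e else - φ e) else 0 := by
      intro e
      simp only [List.count_cons, beq_iff_eq, Prod.mk.injEq]
      by_cases h : a = e <;> cases b <;> simp [h] <;> ring
    rw [Finset.sum_congr rfl fun e _ => this e, Finset.sum_add_distrib, ← ih, Finset.sum_ite_eq,
      if_pos (Finset.mem_univ _), List.map_cons, List.sum_cons, add_comm, ← hu.sub_eq]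
    cases b <;> simp [rev]

end IsPotential

/-- The potential difference between the ends of the cut. -/
theorem IsPotential.sub_eq_index [Fintype E] (hC : Γ.IsCut) {p q : List E} {u : E × Bool → ℚ}
    (hu : Γ.IsPotential u (pathDiff p q)) {i : Fin m} {j : Fin n} {e f : E} (hi : i.val = 0)
    (hj : j.val = 0) (he : Γ.tail e = .source i) (hf : Γ.head f = .sink j) :
    u (e, true) - u (f, true) = Γ.index p - Γ.index q := by
  rw [hu.sub_of_isDualWalk (hC i j e f hi hj he hf), hu.sum_cut, sum_pathDiff_mul]
  unfold index
  simp only [Int.cast_list_sum, List.map_map]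
  rfl

/-- On a common edge of two paths, the potential of their difference is the difference of the
indices of their initial segments. -/
theorem IsPotential.sub_eq_index_of_shared [Fintype E] (hΓ : Γ.IsPerfectCylindrical)
    {p₁ p₂ q₁ q₂ : List E} {e : E} {k i : Fin m} {j l : Fin n}
    (hp₁ : Γ.IsPath (.source k) p₁ (Γ.tail e)) (hp₂ : Γ.IsPath (Γ.head e) p₂ (.sink j))
    (hq₁ : Γ.IsPath (.source i) q₁ (Γ.tail e)) (hq₂ : Γ.IsPath (Γ.head e) q₂ (.sink l))
    {u : E × Bool → ℚ} (hu : Γ.IsPotential u (pathDiff (p₁ ++ e :: p₂) (q₁ ++ e :: q₂)))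
    {i₀ : Fin m} (hi₀ : i₀.val = 0) {e₀ : E} (he₀ : Γ.tail e₀ = .source i₀) :
    u (e₀, true) - u (e, true) = Γ.index p₁ - Γ.index q₁ := by
  obtain ⟨hP, hE, hC, hA⟩ := hΓ
  -- The initial parts `p₁`, `q₁` already differ by a cycle, so `u` is the sum of a potential `u'`
  -- for them and a potential for `p₂ - q₂`. By acyclicity the latter does not jump along `p₁`, and
  -- `u'` does not jump along `p₂`. Hence the drop of `u` from the top source to `e` equals the drop
  -- of `u'` from the top source to the top sink, which the cut computes.
  obtain ⟨u', hu'⟩ := exists_isPotential_pathDiff hP hE hp₁ hq₁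
    (fun X hs _ => by rw [hs k i])
  have hw : Γ.IsPotential (u - u') (pathDiff p₂ q₂) := by
    convert hu.sub hu' using 1
    ext f
    simp only [pathDiff, Pi.sub_apply, List.count_append, List.count_cons]
    push_cast
    ring
  obtain ⟨e₁, he₁, -⟩ := exists_unique_sourceEdge hP k
  obtain ⟨f₀, hf₀, -⟩ := exists_unique_sinkEdge hP (⟨0, j.pos⟩ : Fin n)
  obtain ⟨f₁, hf₁, -⟩ := exists_unique_sinkEdge hP j
  have supp₂ : ∀ f, pathDiff p₂ q₂ f ≠ 0 → ∃ r, Γ.IsPath (Γ.head e) r (Γ.tail f) := fun f hf =>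
    (pathDiff_ne_zero hf).elim (fun h => (hp₂.of_mem h).1) (fun h => (hq₂.of_mem h).1)
  have supp₁ : ∀ f, pathDiff p₁ q₁ f ≠ 0 → ∃ r, Γ.IsPath (Γ.head f) r (Γ.tail e) := fun f hf =>
    (pathDiff_ne_zero hf).elim (fun h => (hp₁.of_mem h).2) (fun h => (hq₁.of_mem h).2)
  -- An edge of `p₂` or `q₂` attached to a vertex of `p₁` would close an oriented cycle through `e`.
  have h₁ : (u - u') (e₁, true) = (u - u') (e, true) := by
    refine hw.eq_of_path hP hE hp₁ ?_ he₁ rfl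
    rintro c ⟨f, b⟩ - ⟨q, hq⟩ hd
    by_contra hne
    obtain ⟨r, hr⟩ := supp₂ f hne
    cases b
    · have hd : Γ.head f = c := hd
      exact not_isPath_head_tail hA ((hr.append (isPath_singleton f)).append (hd ▸ hq))
    · have hd : Γ.tail f = c := hd
      exact not_isPath_head_tail hA (hr.append (hd ▸ hq))
  have h₂ : (u - u') (e₀, true) = (u - u') (e₁, true) := by
    refine eq_of_base_source hP hE (fun d i hd => hw.rot_eq_of_eq_zero ?_) he₀ he₁
    by_contra hne
    obtain ⟨r, hr⟩ := supp₂ _ hne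
    have hd' := hE.rot_source d i hd
    have htail : Γ.tail (Γ.rot d).1 = .source ((finRotate m).symm i) := by
      obtain ⟨e', he', hu'⟩ := exists_unique_sourceEdge hP ((finRotate m).symm i)
      rw [hu' _ hd']; exact he'
    rw [htail] at hr
    obtain rfl := hr.eq_nil_of_source hP
    exact hP.source_out _ _ hr
  have nosink : ∀ {f : E} {j' : Fin n}, Γ.head f = .sink j' → pathDiff p₁ q₁ f = 0 := by
    intro f j' hf
    by_contra hne
    obtain ⟨r, hr⟩ := supp₁ _ hne
    rw [hf] at hr
    obtain rfl := hr.eq_nil_of_sink hP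
    exact hP.sink_in _ _ hr.symm
  have h₃ : u' (e, false) = u' (f₁, false) := by
    refine hu'.eq_of_path hP hE hp₂ ?_ rfl hf₁
    rintro c ⟨f, b⟩ ⟨q, hq⟩ - hd
    by_contra hne
    obtain ⟨r, hr⟩ := supp₁ f hne
    cases b
    · have hd : Γ.head f = c := hd
      exact not_isPath_head_tail hA (hq.append (hd ▸ hr))
    · have hd : Γ.tail f = c := hd
      exact not_isPath_head_tail hA ((hq.append (hd ▸ isPath_singleton f)).append hr)
  have h₄ : u' (f₁, false) = u' (f₀, false) := by
    refine eq_of_base_sink hP hE (fun d i hd => hu'.rot_eq_of_eq_zero ?_) hf₁ hf₀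
    have hd' := hE.rot_sink d i hd
    obtain ⟨e', he', hu'⟩ := exists_unique_sinkEdge hP (finRotate n i)
    rw [hu' _ hd']
    exact nosink he'
  have h₅ : u' (f₀, false) = u' (f₀, true) := hu'.rev_eq_of_eq_zero (d := (f₀, true)) (nosink hf₀)
  have h₆ : u' (e, false) = u' (e, true) := hu'.rev_eq_of_eq_zero (d := (e, true)) (by
    by_contra hne
    obtain ⟨r, hr⟩ := supp₁ e hne
    exact not_isPath_head_tail hA hr)
  have h₇ := hu'.sub_eq_index hC hi₀ rfl he₀ hf₀
  simp only [Pi.sub_apply] at h₁ h₂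
  linarith

end CylNetwork

namespace CylNetwork

section Vertices

variable {m n : ℕ} {V E : Type*} {Γ : CylNetwork m n V E}

/-! ### White and black vertices -/

variable (Γ) in
/-- The edges at the white vertex `v` are exactly `x₁`, `x₂`, `x₃`. -/
structure WhiteAt (v : V) (x₁ x₂ x₃ : E) : Prop where
  isWhite : Γ.IsWhite v x₁ x₂ x₃
  tail₁ : Γ.tail x₁ = .inner v
  tail₂ : Γ.tail x₂ = .inner v
  ne : x₁ ≠ x₂
  eq_of_head (e : E) : Γ.head e = .inner v → e = x₃
  eq_of_tail (e : E) : Γ.tail e = .inner v → e = x₁ ∨ e = x₂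

variable (Γ) in
/-- The edges at the black vertex `v` are exactly `y₁`, `y₂`, `y₃`. -/
structure BlackAt (v : V) (y₁ y₂ y₃ : E) : Prop where
  isBlack : Γ.IsBlack v y₁ y₂ y₃
  head₁ : Γ.head y₁ = .inner v
  head₂ : Γ.head y₂ = .inner v
  ne : y₁ ≠ y₂
  eq_of_tail (e : E) : Γ.tail e = .inner v → e = y₃
  eq_of_head (e : E) : Γ.head e = .inner v → e = y₁ ∨ e = y₂

/-- Rotation is a single cycle on the three half-edges at the vertex, so a set that contains `d` and
is closed under `rot` has at least three elements. -/
theorem exists_rot_cycle [Fintype E] (hΓ : Γ.IsPerfect) (hE : Γ.IsEmbedded) {v : V}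
    {d : E × Bool} (hd : Γ.base d = .inner v) :
    d ≠ Γ.rot d ∧ Γ.rot d ≠ Γ.rot (Γ.rot d) ∧ d ≠ Γ.rot (Γ.rot d) ∧
      Γ.rot (Γ.rot (Γ.rot d)) = d ∧
      ∀ d', Γ.base d' = .inner v → d' = d ∨ d' = Γ.rot d ∨ d' = Γ.rot (Γ.rot d) := by
  classical
  set S : Finset (E × Bool) := Finset.univ.filter fun d => Γ.base d = .inner v
  have hS : S.card = 3 := by
    rw [← hΓ.trivalent v, Nat.card_eq_fintype_card, Fintype.card_subtype]
  have key : ∀ A : Finset (E × Bool), d ∈ A → (∀ a ∈ A, Γ.rot a ∈ A) → S ⊆ A := by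
    intro A h₁ h₂ d' hd'
    obtain ⟨N, -, -, rfl⟩ :=
      (hE.rot_inner_cyclic d d' v hd (Finset.mem_filter.1 hd').2).exists_pow_eq'
    clear hd'
    induction N with
    | zero => exact h₁
    | succ N ih => rw [pow_succ']; exact h₂ _ ih
  have h₁ : d ≠ Γ.rot d := by
    intro h
    have := Finset.card_le_card (key {d} (by simp) (by simp [← h]))
    simp [hS] at this
  have h₂ : d ≠ Γ.rot (Γ.rot d) := by
    intro h
    have := Finset.card_le_card (key {d, Γ.rot d} (by simp) (by simp [← h]))
    have := this.trans Finset.card_le_two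
    omega
  have h₃ : Γ.rot d ≠ Γ.rot (Γ.rot d) := fun h => h₁ (Γ.rot.injective h)
  have hr := hE.rot_inner d v hd
  have hrr := hE.rot_inner _ v hr
  have hT : ({d, Γ.rot d, Γ.rot (Γ.rot d)} : Finset (E × Bool)) = S := by
    refine Finset.eq_of_subset_of_card_le ?_ ?_
    · intro a ha
      simp only [Finset.mem_insert, Finset.mem_singleton] at ha
      rcases ha with rfl | rfl | rfl <;> simp [S, hd, hr, hrr]
    · rw [hS, Finset.card_eq_three.2 ⟨_, _, _, h₁, h₂, h₃, rfl⟩]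
  have hall : ∀ d', Γ.base d' = .inner v → d' = d ∨ d' = Γ.rot d ∨ d' = Γ.rot (Γ.rot d) := by
    intro d' hd'
    have : d' ∈ S := by simp [S, hd']
    simpa [← hT] using this
  refine ⟨h₁, h₃, h₂, ?_, hall⟩
  rcases hall _ (hE.rot_inner _ v hrr) with h | h | h
  · exact h
  · exact absurd (Γ.rot.injective h).symm h₂
  · exact absurd (Γ.rot.injective (Γ.rot.injective h)).symm h₁

/-- Start from an incoming half-edge. If the next two are outgoing the vertex is white, if exactly
one is outgoing it is black, and two further incoming ones would make it a sink. -/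
theorem whiteAt_or_blackAt [Fintype E] (hΓ : Γ.IsPerfect) (hE : Γ.IsEmbedded) (v : V) :
    (∃ x₁ x₂ x₃, Γ.WhiteAt v x₁ x₂ x₃) ∨ ∃ y₁ y₂ y₃, Γ.BlackAt v y₁ y₂ y₃ := by
  obtain ⟨x, hx⟩ := hΓ.inner_not_source v
  have hd : Γ.base (x, false) = .inner v := hx
  obtain ⟨h₁, h₂, h₃, h₄, hall⟩ := exists_rot_cycle hΓ hE hd
  have hr := hE.rot_inner _ v hd
  have hrr := hE.rot_inner _ v hr
  obtain ⟨a, b₁, ha⟩ : ∃ a b₁, Γ.rot (x, false) = (a, b₁) := ⟨_, _, rfl⟩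
  obtain ⟨b, b₂, hb⟩ : ∃ b b₂, Γ.rot (Γ.rot (x, false)) = (b, b₂) := ⟨_, _, rfl⟩
  rw [hb] at h₂ h₃ h₄ hall hrr
  rw [ha] at h₁ h₂ hb hr hall
  have hin : ∀ e, Γ.head e = .inner v → (e, false) = (x, false) ∨ (e, false) = (a, b₁) ∨
    (e, false) = (b, b₂) := fun e he => hall (e, false) he
  have hout : ∀ e, Γ.tail e = .inner v → (e, true) = (x, false) ∨ (e, true) = (a, b₁) ∨
    (e, true) = (b, b₂) := fun e he => hall (e, true) he
  simp only [Prod.mk.injEq] at hin hout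
  cases b₁ <;> cases b₂ <;> simp only [reduceCtorEq, and_true, and_false, or_false, false_or]
    at hin hout
  · obtain ⟨e, he⟩ := hΓ.inner_not_sink v
    exact (hout e he).elim
  · exact .inr ⟨x, a, b, ⟨hrr, h₄, ha, hb⟩, hx, hr, fun h => h₁ (h ▸ rfl), hout, hin⟩
  · exact .inr ⟨b, x, a, ⟨hr, hb, h₄, ha⟩, hrr, hx, fun h => h₃ (h ▸ rfl), hout,
      fun e he => (hin e he).symm⟩
  · exact .inl ⟨a, b, x, ⟨hx, ha, hb, h₄⟩, hr, hrr, fun h => h₂ (h ▸ rfl), hin, hout⟩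

theorem WhiteAt.isWhite_iff {v : V} {x₁ x₂ x₃ : E} (h : Γ.WhiteAt v x₁ x₂ x₃) {y₁ y₂ y₃ : E} :
    Γ.IsWhite v y₁ y₂ y₃ ↔ y₁ = x₁ ∧ y₂ = x₂ ∧ y₃ = x₃ := by
  constructor
  · rintro ⟨h₀, h₁, h₂, -⟩
    obtain rfl := h.eq_of_head _ h₀
    obtain ⟨-, g₁, g₂, -⟩ := h.isWhite
    obtain rfl : y₁ = x₁ := congrArg Prod.fst (h₁.symm.trans g₁)
    obtain rfl : y₂ = x₂ := congrArg Prod.fst (h₂.symm.trans g₂)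
    exact ⟨rfl, rfl, rfl⟩
  · rintro ⟨rfl, rfl, rfl⟩
    exact h.isWhite

theorem BlackAt.isBlack_iff {v : V} {x₁ x₂ x₃ : E} (h : Γ.BlackAt v x₁ x₂ x₃) {y₁ y₂ y₃ : E} :
    Γ.IsBlack v y₁ y₂ y₃ ↔ y₁ = x₁ ∧ y₂ = x₂ ∧ y₃ = x₃ := by
  constructor
  · rintro ⟨h₀, h₁, h₂, -⟩
    obtain rfl := h.eq_of_tail _ h₀
    obtain ⟨-, g₁, g₂, -⟩ := h.isBlack
    obtain rfl : y₁ = x₁ := congrArg Prod.fst (h₁.symm.trans g₁)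
    obtain rfl : y₂ = x₂ := congrArg Prod.fst (h₂.symm.trans g₂)
    exact ⟨rfl, rfl, rfl⟩
  · rintro ⟨rfl, rfl, rfl⟩
    exact h.isBlack

theorem WhiteAt.not_isBlack {v : V} {x₁ x₂ x₃ : E} (h : Γ.WhiteAt v x₁ x₂ x₃) {y₁ y₂ y₃ : E} :
    ¬ Γ.IsBlack v y₁ y₂ y₃ := by
  rintro ⟨h₀, h₁, h₂, h₃⟩
  obtain ⟨-, g₁, g₂, g₃⟩ := h.isWhite
  rcases h.eq_of_tail _ h₀ with rfl | rfl
  · rw [g₂] at h₁; simp at h₁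
  · obtain rfl : x₃ = y₁ := congrArg Prod.fst (g₃.symm.trans h₁)
    rw [g₁] at h₂; simp at h₂

theorem BlackAt.not_isWhite {v : V} {x₁ x₂ x₃ : E} (h : Γ.BlackAt v x₁ x₂ x₃) {y₁ y₂ y₃ : E} :
    ¬ Γ.IsWhite v y₁ y₂ y₃ := by
  rintro ⟨h₀, h₁, h₂, h₃⟩
  obtain ⟨-, g₁, g₂, g₃⟩ := h.isBlack
  rcases h.eq_of_head _ h₀ with rfl | rfl
  · rw [g₂] at h₁; simp at h₁
  · obtain rfl : x₃ = y₁ := congrArg Prod.fst (g₃.symm.trans h₁)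
    rw [g₁] at h₂; simp at h₂

theorem sum_triple_eq {M : Type*} [AddCommMonoid M] [Fintype E] {x₁ x₂ x₃ : E}
    (F : E → E → E → M)
    (h : ∀ y₁ y₂ y₃, ¬ (y₁ = x₁ ∧ y₂ = x₂ ∧ y₃ = x₃) → F y₁ y₂ y₃ = 0) :
    ∑ y₁, ∑ y₂, ∑ y₃, F y₁ y₂ y₃ = F x₁ x₂ x₃ := by
  rw [Finset.sum_eq_single x₁, Finset.sum_eq_single x₂, Finset.sum_eq_single x₃]
  · exact fun y _ hy => h _ _ _ fun h' => hy h'.2.2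
  · simp
  · exact fun y _ hy => Finset.sum_eq_zero fun z _ => h _ _ _ fun h' => hy h'.2.1
  · simp
  · exact fun y _ hy => Finset.sum_eq_zero fun z _ => Finset.sum_eq_zero fun t _ =>
      h _ _ _ fun h' => hy h'.1
  · simp

open Classical in
theorem WhiteAt.sum_eq {M : Type*} [AddCommMonoid M] [Fintype E] {v : V} {x₁ x₂ x₃ : E}
    (h : Γ.WhiteAt v x₁ x₂ x₃) (F F' : E → E → E → M) :
    ∑ y₁, ∑ y₂, ∑ y₃, ((if Γ.IsWhite v y₁ y₂ y₃ then F y₁ y₂ y₃ else 0) +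
      if Γ.IsBlack v y₁ y₂ y₃ then F' y₁ y₂ y₃ else 0) = F x₁ x₂ x₃ := by
  rw [sum_triple_eq (x₁ := x₁) (x₂ := x₂) (x₃ := x₃), if_pos h.isWhite, if_neg h.not_isBlack,
    add_zero]
  intro y₁ y₂ y₃ hy
  rw [if_neg (h.isWhite_iff.not.2 hy), if_neg h.not_isBlack, add_zero]

open Classical in
theorem BlackAt.sum_eq {M : Type*} [AddCommMonoid M] [Fintype E] {v : V} {x₁ x₂ x₃ : E}
    (h : Γ.BlackAt v x₁ x₂ x₃) (F F' : E → E → E → M) :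
    ∑ y₁, ∑ y₂, ∑ y₃, ((if Γ.IsWhite v y₁ y₂ y₃ then F y₁ y₂ y₃ else 0) +
      if Γ.IsBlack v y₁ y₂ y₃ then F' y₁ y₂ y₃ else 0) = F' x₁ x₂ x₃ := by
  rw [sum_triple_eq (x₁ := x₁) (x₂ := x₂) (x₃ := x₃), if_pos h.isBlack, if_neg h.not_isWhite,
    zero_add]
  intro y₁ y₂ y₃ hy
  rw [if_neg (h.isBlack_iff.not.2 hy), if_neg h.not_isWhite, add_zero]

/-! ### Paths through a vertex -/

theorem not_mem_and_mem_of_tail_eq (hΓ : Γ.IsAcyclic) {p : List E} {a b : NetVertex m n V}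
    (hp : Γ.IsPath a p b) {x y : E} (hxy : x ≠ y) (h : Γ.tail x = Γ.tail y) :
    ¬ (x ∈ p ∧ y ∈ p) := by
  rintro ⟨hx, hy⟩
  obtain ⟨q, r, rfl⟩ := List.append_of_mem hx
  rw [isPath_append_cons] at hp
  rcases List.mem_append.1 hy with hy | hy
  · obtain ⟨s, hs⟩ := (hp.1.of_mem hy).2
    exact not_isPath_head_tail hΓ (h ▸ hs)
  · rcases List.mem_cons.1 hy with rfl | hy
    · exact hxy rfl
    · obtain ⟨s, hs⟩ := (hp.2.of_mem hy).1
      exact not_isPath_head_tail hΓ (h ▸ hs)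

theorem not_mem_and_mem_of_head_eq (hΓ : Γ.IsAcyclic) {p : List E} {a b : NetVertex m n V}
    (hp : Γ.IsPath a p b) {x y : E} (hxy : x ≠ y) (h : Γ.head x = Γ.head y) :
    ¬ (x ∈ p ∧ y ∈ p) := by
  rintro ⟨hx, hy⟩
  obtain ⟨q, r, rfl⟩ := List.append_of_mem hx
  rw [isPath_append_cons] at hp
  rcases List.mem_append.1 hy with hy | hy
  · obtain ⟨s, hs⟩ := (hp.1.of_mem hy).2
    exact not_isPath_head_tail hΓ (h ▸ hs)
  · rcases List.mem_cons.1 hy with rfl | hy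
    · exact hxy rfl
    · obtain ⟨s, hs⟩ := (hp.2.of_mem hy).1
      exact not_isPath_head_tail hΓ (h ▸ hs)

theorem IsPath.exists_prev {p : List E} {k : Fin m} {b : NetVertex m n V}
    (hp : Γ.IsPath (.source k) p b) {e : E} (he : e ∈ p) {v : V} (hv : Γ.tail e = .inner v) :
    ∃ f q r, Γ.head f = .inner v ∧ p = q ++ f :: e :: r := by
  obtain ⟨q, r, rfl⟩ := List.append_of_mem he
  have h := (isPath_append_cons.1 hp).1
  rcases List.eq_nil_or_concat q with rfl | ⟨s, f, rfl⟩
  · rw [hv] at h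
    cases h
  · rw [List.concat_eq_append] at h ⊢
    exact ⟨f, s, r, (isPath_append_cons.1 h).2.trans hv, by simp⟩

theorem IsPath.exists_next {p : List E} {a : NetVertex m n V} {j : Fin n}
    (hp : Γ.IsPath a p (.sink j)) {e : E} (he : e ∈ p) {v : V} (hv : Γ.head e = .inner v) :
    ∃ f q r, Γ.tail f = .inner v ∧ p = q ++ e :: f :: r := by
  obtain ⟨q, r, rfl⟩ := List.append_of_mem he
  have h := (isPath_append_cons.1 hp).2
  cases r with
  | nil => rw [hv] at h; cases h
  | cons f r => exact ⟨f, q, r, h.1.trans hv, rfl⟩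

theorem WhiteAt.exists_eq_append {v : V} {x₁ x₂ x₃ : E} (h : Γ.WhiteAt v x₁ x₂ x₃)
    {p : List E} {k : Fin m} {b : NetVertex m n V} (hp : Γ.IsPath (.source k) p b) {x : E}
    (hx : x ∈ p) (hv : Γ.tail x = .inner v) : ∃ q r, p = q ++ x₃ :: x :: r := by
  obtain ⟨f, q, r, hf, rfl⟩ := hp.exists_prev hx hv
  exact ⟨q, r, by rw [h.eq_of_head f hf]⟩

theorem BlackAt.exists_eq_append {v : V} {y₁ y₂ y₃ : E} (h : Γ.BlackAt v y₁ y₂ y₃)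
    {p : List E} {a : NetVertex m n V} {j : Fin n} (hp : Γ.IsPath a p (.sink j)) {y : E}
    (hy : y ∈ p) (hv : Γ.head y = .inner v) : ∃ q r, p = q ++ y :: y₃ :: r := by
  obtain ⟨f, q, r, hf, rfl⟩ := hp.exists_next hy hv
  exact ⟨q, r, by rw [h.eq_of_tail f hf]⟩

theorem WhiteAt.mem_iff {v : V} {x₁ x₂ x₃ : E} (h : Γ.WhiteAt v x₁ x₂ x₃)
    {p : List E} {k : Fin m} {j : Fin n} (hp : Γ.IsPath (.source k) p (.sink j)) :
    x₃ ∈ p ↔ x₁ ∈ p ∨ x₂ ∈ p := by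
  constructor
  · intro hx
    obtain ⟨f, q, r, hf, rfl⟩ := hp.exists_next hx h.isWhite.1
    rcases h.eq_of_tail f hf with rfl | rfl <;> simp
  · rintro (hx | hx)
    · obtain ⟨q, r, rfl⟩ := h.exists_eq_append hp hx h.tail₁
      simp
    · obtain ⟨q, r, rfl⟩ := h.exists_eq_append hp hx h.tail₂
      simp

theorem BlackAt.mem_iff {v : V} {y₁ y₂ y₃ : E} (h : Γ.BlackAt v y₁ y₂ y₃)
    {p : List E} {k : Fin m} {j : Fin n} (hp : Γ.IsPath (.source k) p (.sink j)) :
    y₃ ∈ p ↔ y₁ ∈ p ∨ y₂ ∈ p := by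
  constructor
  · intro hy
    obtain ⟨f, q, r, hf, rfl⟩ := hp.exists_prev hy h.isBlack.1
    rcases h.eq_of_head f hf with rfl | rfl <;> simp
  · rintro (hy | hy)
    · obtain ⟨q, r, rfl⟩ := h.exists_eq_append hp hy h.head₁
      simp
    · obtain ⟨q, r, rfl⟩ := h.exists_eq_append hp hy h.head₂
      simp

open Classical in
variable (Γ) in
/-- The index of the part of the path `p` before the edge `e`. -/
noncomputable def indexBefore (p : List E) (e : E) : ℤ :=
  Γ.index (p.takeWhile fun f => f ≠ e)

theorem indexBefore_append_cons {p q : List E} {e : E} (h : e ∉ p) :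
    Γ.indexBefore (p ++ e :: q) e = Γ.index p := by
  classical
  unfold indexBefore
  rw [List.takeWhile_append_of_pos]
  · simp
  · intro f hf
    simp only [ne_eq, decide_not, Bool.not_eq_eq_eq_not, Bool.not_true, decide_eq_false_iff_not]
    rintro rfl
    exact h hf

/-! ### The flux of a function along a path -/

open Classical in
-- Every edge of `p` except the last enters an inner vertex, and every edge except the first leaves
-- one.
theorem sum_flux {M : Type*} [AddCommGroup M] [Fintype V] [Fintype E]
    (hΓ : Γ.IsPerfect) {p : List E} {k : Fin m} {j : Fin n}
    (hp : Γ.IsPath (.source k) p (.sink j)) {e f : E} (he : Γ.tail e = .source k)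
    (hf : Γ.head f = .sink j) (g : E → M) :
    ∑ v : V, ((∑ a, if Γ.head a = .inner v then (if a ∈ p then g a else 0) else 0) -
      ∑ a, if Γ.tail a = .inner v then (if a ∈ p then g a else 0) else 0) = g e - g f := by
  obtain ⟨e', he', hue⟩ := exists_unique_sourceEdge hΓ k
  obtain ⟨f', hf', huf⟩ := exists_unique_sinkEdge hΓ j
  obtain rfl : e = e' := congrArg Prod.fst (hue (e, true) he)
  obtain rfl : f = f' := congrArg Prod.fst (huf (f, false) hf)
  have hep : e ∈ p := by
    cases p with
    | nil => cases hp
    | cons a p => obtain rfl : a = e := congrArg Prod.fst (hue (a, true) hp.1); simp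
  have hfp : f ∈ p := by
    rcases List.eq_nil_or_concat p with rfl | ⟨s, a, rfl⟩
    · cases hp
    · rw [List.concat_eq_append] at hp ⊢
      obtain rfl : a = f := congrArg Prod.fst (huf (a, false) (isPath_append_cons.1 hp).2)
      simp
  have hin : ∀ a, (∑ v : V, if Γ.head a = .inner v then (if a ∈ p then g a else 0) else 0) =
      (if a ∈ p then g a else 0) - if a = f then g f else 0 := by
    intro a
    by_cases hap : a ∈ p
    swap
    · have : a ≠ f := fun h => hap (h ▸ hfp)
      simp [hap, this]
    by_cases haf : a = f
    · subst haf
      simp [hf, hap]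
    · cases hh : Γ.head a with
      | source i => exact absurd hh (hΓ.source_out i a)
      | inner v => simp [haf]
      | sink j' =>
        obtain ⟨q, hq⟩ := (hp.of_mem hap).2
        rw [hh] at hq
        obtain rfl := hq.eq_nil_of_sink hΓ
        exact absurd (congrArg Prod.fst (huf (a, false) (hh.trans hq))) haf
  have hout : ∀ a, (∑ v : V, if Γ.tail a = .inner v then (if a ∈ p then g a else 0) else 0) =
      (if a ∈ p then g a else 0) - if a = e then g e else 0 := by
    intro a
    by_cases hap : a ∈ p
    swap
    · have : a ≠ e := fun h => hap (h ▸ hep)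
      simp [hap, this]
    by_cases hae : a = e
    · subst hae
      simp [he, hap]
    · cases hh : Γ.tail a with
      | sink j => exact absurd hh (hΓ.sink_in j a)
      | inner v => simp [hae]
      | source i =>
        obtain ⟨q, hq⟩ := (hp.of_mem hap).1
        rw [hh] at hq
        obtain rfl := hq.eq_nil_of_source hΓ
        exact absurd (congrArg Prod.fst (hue (a, true) (hh.trans hq.symm))) hae
  rw [Finset.sum_sub_distrib, Finset.sum_comm, Finset.sum_congr rfl fun a _ => hin a]
  rw [Finset.sum_comm, Finset.sum_congr rfl fun a _ => hout a, Finset.sum_sub_distrib, Finset.sum_sub_distrib,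
    Finset.sum_ite_eq', Finset.sum_ite_eq', if_pos (Finset.mem_univ _), if_pos (Finset.mem_univ _)]
  abel

theorem mem_iff_of_tail_source (hΓ : Γ.IsPerfect) {p : List E} {k i : Fin m}
    {j : Fin n} (hp : Γ.IsPath (.source k) p (.sink j)) {e : E} (he : Γ.tail e = .source i) :
    e ∈ p ↔ i = k := by
  constructor
  · intro h
    obtain ⟨q, hq⟩ := (hp.of_mem h).1
    rw [he] at hq
    obtain rfl := hq.eq_nil_of_source hΓ
    cases hq
    rfl
  · rintro rfl
    cases p with
    | nil => cases hp
    | cons a p =>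
      obtain ⟨e', -, hu⟩ := exists_unique_sourceEdge hΓ i
      obtain rfl : a = e := congrArg Prod.fst ((hu (a, true) hp.1).trans (hu (e, true) he).symm)
      simp

theorem mem_iff_of_head_sink (hΓ : Γ.IsPerfect) {p : List E} {k : Fin m}
    {j l : Fin n} (hp : Γ.IsPath (.source k) p (.sink j)) {e : E} (he : Γ.head e = .sink l) :
    e ∈ p ↔ l = j := by
  constructor
  · intro h
    obtain ⟨q, hq⟩ := (hp.of_mem h).2
    rw [he] at hq
    obtain rfl := hq.eq_nil_of_sink hΓ
    cases hq
    rfl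
  · rintro rfl
    rcases List.eq_nil_or_concat p with rfl | ⟨s, a, rfl⟩
    · cases hp
    · rw [List.concat_eq_append] at hp ⊢
      obtain ⟨e', -, hu⟩ := exists_unique_sinkEdge hΓ l
      obtain rfl : a = e := congrArg Prod.fst
        ((hu (a, false) (isPath_append_cons.1 hp).2).trans (hu (e, false) he).symm)
      simp

end Vertices

end CylNetwork

namespace CylNetwork

/-! ### The coefficients of the r-matrix as a discrete primitive -/

section Primitive

variable {k : Type*} [Field k]

/-- A function of half-integers whose differences over steps of length `1 / 2` are half the values
of `h ↦ lam ^ (A - h) * mu ^ (B + h)` at the integral ends of the steps. -/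
noncomputable def halfStep (lam mu : k) (A B : ℤ) (x : ℚ) : k :=
  (if x = ⌊x⌋ then (1 / 2) * ((mu + lam) / (mu - lam)) else mu / (mu - lam)) *
    (lam ^ (A - ⌊x⌋) * mu ^ (B + ⌊x⌋))

theorem halfStep_intCast (lam mu : k) (A B h : ℤ) : halfStep lam mu A B h =
    (1 / 2) * ((mu + lam) / (mu - lam)) * (lam ^ (A - h) * mu ^ (B + h)) := by
  simp [halfStep]

theorem halfStep_add_half (lam mu : k) (A B h : ℤ) : halfStep lam mu A B (h + 1 / 2) =
    mu / (mu - lam) * (lam ^ (A - h) * mu ^ (B + h)) := by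
  have : ⌊(h : ℚ) + 1 / 2⌋ = h := by
    rw [Int.floor_eq_iff]; constructor <;> linarith
  unfold halfStep
  rw [this, if_neg (by linarith)]

/-- The floor is now `h - 1`; moving one factor from `mu` to `lam` in the monomial turns `mu / (mu -
lam)` into `lam / (mu - lam)`. Thus one function produces both kinds of off-diagonal coefficients.
-/
theorem halfStep_sub_half {lam mu : k} (hlam : lam ≠ 0) (hmu : mu ≠ 0) (A B h : ℤ) :
    halfStep lam mu A B (h - 1 / 2) =
      lam / (mu - lam) * (lam ^ (A - h) * mu ^ (B + h)) := by
  have h₁ : (h : ℚ) - 1 / 2 = ((h - 1 : ℤ) : ℚ) + 1 / 2 := by push_cast; ring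
  rw [h₁, halfStep_add_half, show A - (h - 1) = (A - h) + 1 by ring,
    show B + h = (B + (h - 1)) + 1 by ring, zpow_add_one₀ hlam, zpow_add_one₀ hmu]
  ring

theorem halfStep_sub_halfStep_add [NeZero (2 : k)] {lam mu : k} (hne : lam ≠ mu) (A B h : ℤ) :
    halfStep lam mu A B h - halfStep lam mu A B (h + 1 / 2) =
      -(1 / 2 * (lam ^ (A - h) * mu ^ (B + h))) := by
  rw [halfStep_intCast, halfStep_add_half]
  have : mu - lam ≠ 0 := sub_ne_zero.2 hne.symm
  have := two_ne_zero (α := k)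
  field_simp
  ring

theorem halfStep_sub_halfStep_sub [NeZero (2 : k)] {lam mu : k} (hlam : lam ≠ 0) (hmu : mu ≠ 0)
    (hne : lam ≠ mu) (A B h : ℤ) :
    halfStep lam mu A B h - halfStep lam mu A B (h - 1 / 2) =
      1 / 2 * (lam ^ (A - h) * mu ^ (B + h)) := by
  rw [halfStep_intCast, halfStep_sub_half hlam hmu]
  have : mu - lam ≠ 0 := sub_ne_zero.2 hne.symm
  have := two_ne_zero (α := k)
  field_simp
  ring

/-- The coefficient of `E a b ⊠ E b a` in the trigonometric `r`-matrix. -/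
noncomputable def trigCoeff {N : ℕ} (lam mu : k) (a b : Fin N) : k :=
  if a = b then (1 / 2) * ((mu + lam) / (mu - lam))
  else if a < b then lam / (mu - lam) else mu / (mu - lam)

/-- The values at `h`, `h - 1/2` and `h + 1/2` carry the coefficients of `r` for `a = b`, `a < b`
and `a > b`. -/
theorem halfStep_eq_trigCoeff {lam mu : k} (hlam : lam ≠ 0) (hmu : mu ≠ 0) (A B h : ℤ) {N : ℕ}
    (a b : Fin N) {x : ℚ}
    (hx : x = h + ((if b < a then 1 else 0) - (if a < b then 1 else 0)) / 2) :
    halfStep lam mu A B x = trigCoeff lam mu a b * (lam ^ (A - h) * mu ^ (B + h)) := by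
  unfold trigCoeff
  rcases lt_trichotomy a b with h | rfl | h
  · rw [hx, if_neg h.ne, if_pos h, if_neg h.not_gt, if_pos h, ← halfStep_sub_half hlam hmu]
    congr 1
    ring
  · rw [hx, if_pos rfl, if_neg (lt_irrefl _), ← halfStep_intCast]
    congr 1
    ring
  · rw [hx, if_neg h.ne', if_neg h.not_gt, if_pos h, if_neg h.not_gt, ← halfStep_add_half]
    congr 1
    ring

/-- To be applied with `x i` and `y i` the potential above and below the `i`-th boundary edge. Going
down the circle, it drops by one past `a` and rises by one past `b`, so the mean level at `a` only
sees which of the two comes first. -/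
theorem sub_mean_of_rec {N : ℕ} {x y : Fin N → ℚ} {i₀ a b : Fin N}
    (h₀ : i₀.val = 0) (hrec : ∀ i i' : Fin N, i'.val = i.val + 1 → x i' = y i)
    (hc : ∀ i, x i - y i = (if i = a then 1 else 0) - (if i = b then 1 else 0)) :
    x i₀ - (x a + y a) / 2 = ((if a < b then 1 else 0) - (if b < a then 1 else 0)) / 2 := by
  have key : ∀ (M : ℕ) (i : Fin N), i.val = M →
      x i₀ - x i = (if a < i then 1 else 0) - (if b < i then 1 else 0) := by
    intro M
    induction M with
    | zero =>
      intro i hi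
      obtain rfl : i = i₀ := Fin.ext (hi.trans h₀.symm)
      have h₁ : ∀ c : Fin N, ¬ c < i := fun c hc => by
        have := Fin.lt_def.1 hc; omega
      simp [h₁]
    | succ M ih =>
      intro i' hi'
      have hM : M < N := by have := i'.2; omega
      have h := ih ⟨M, hM⟩ rfl
      have h' := hc ⟨M, hM⟩
      rw [← hrec ⟨M, hM⟩ i' hi'] at h'
      have step : ∀ c : Fin N, (if c < i' then (1 : ℚ) else 0) =
          (if c < (⟨M, hM⟩ : Fin N) then 1 else 0) + if (⟨M, hM⟩ : Fin N) = c then 1 else 0 := by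
        intro c
        simp only [Fin.lt_def, Fin.ext_iff, hi']
        rcases lt_trichotomy c.val M with h | h | h
        · simp [h, h.ne', h.trans (Nat.lt_succ_self M)]
        · simp [h]
        · have h₁ : ¬ c.val < M + 1 := by omega
          have h₂ : ¬ c.val < M := by omega
          simp [h₁, h₂, h.ne]
      rw [step a, step b]
      linarith
  have h₁ := key _ a rfl
  have h₂ := hc a
  rcases lt_trichotomy a b with h | rfl | h
  · simp [h.ne, h, h.not_gt] at *
    linarith
  · simp at *
    linarith
  · simp [h.ne', h, h.not_gt] at *
    linarith

end Primitive

/-! ### Local contributions to the flux -/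

section Flux

variable {m n : ℕ} {V E : Type*} {Γ : CylNetwork m n V E}

/-- Both paths reach `v` along `x₃`, whose own index cancels in the difference. -/
theorem index_shared_white [Fintype E] (hΓ : Γ.IsPerfectCylindrical) {v : V} {x₁ x₂ x₃ x y : E}
    (h : Γ.WhiteAt v x₁ x₂ x₃) {p q : List E} {a b : Fin m} {j l : Fin n}
    (hp : Γ.IsPath (.source a) p (.sink j)) (hq : Γ.IsPath (.source b) q (.sink l))
    {u : E × Bool → ℚ} (hu : Γ.IsPotential u (pathDiff p q)) {i₀ : Fin m} (hi₀ : i₀.val = 0)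
    {e₀ : E} (he₀ : Γ.tail e₀ = .source i₀) (hx : x ∈ p) (hy : y ∈ q)
    (hxv : Γ.tail x = .inner v) (hyv : Γ.tail y = .inner v) :
    u (e₀, true) - u (x₃, true) = ((Γ.indexBefore p x - Γ.indexBefore q y : ℤ) : ℚ) := by
  have hpn := Γ.nodup_of_isPath hΓ.acyclic hp
  have hqn := Γ.nodup_of_isPath hΓ.acyclic hq
  obtain ⟨p₁, p₂, rfl⟩ := h.exists_eq_append hp hx hxv
  obtain ⟨q₁, q₂, rfl⟩ := h.exists_eq_append hq hy hyv
  have h₁ := isPath_append_cons.1 hp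
  have h₂ := isPath_append_cons.1 hq
  rw [hu.sub_eq_index_of_shared hΓ h₁.1 h₁.2 h₂.1 h₂.2 hi₀ he₀]
  rw [List.append_cons] at hpn hqn
  rw [List.append_cons p₁, List.append_cons q₁]
  rw [indexBefore_append_cons, indexBefore_append_cons, index_append, index_append]
  · push_cast; ring
  · exact fun hm => (List.disjoint_of_nodup_append hqn) hm (by simp)
  · exact fun hm => (List.disjoint_of_nodup_append hpn) hm (by simp)

/-- Here the shared edge `y₃` comes after `x` and `y`, so their own indices must be included. -/
theorem index_shared_black [Fintype E] (hΓ : Γ.IsPerfectCylindrical) {v : V} {y₁ y₂ y₃ x y : E}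
    (h : Γ.BlackAt v y₁ y₂ y₃) {p q : List E} {a b : Fin m} {j l : Fin n}
    (hp : Γ.IsPath (.source a) p (.sink j)) (hq : Γ.IsPath (.source b) q (.sink l))
    {u : E × Bool → ℚ} (hu : Γ.IsPotential u (pathDiff p q)) {i₀ : Fin m} (hi₀ : i₀.val = 0)
    {e₀ : E} (he₀ : Γ.tail e₀ = .source i₀) (hx : x ∈ p) (hy : y ∈ q)
    (hxv : Γ.head x = .inner v) (hyv : Γ.head y = .inner v) :
    u (e₀, true) - u (y₃, true) = (((Γ.indexBefore p x + Γ.index [x]) -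
      (Γ.indexBefore q y + Γ.index [y]) : ℤ) : ℚ) := by
  have hpn := Γ.nodup_of_isPath hΓ.acyclic hp
  have hqn := Γ.nodup_of_isPath hΓ.acyclic hq
  obtain ⟨p₁, p₂, rfl⟩ := h.exists_eq_append hp hx hxv
  obtain ⟨q₁, q₂, rfl⟩ := h.exists_eq_append hq hy hyv
  rw [indexBefore_append_cons fun hm => (List.disjoint_of_nodup_append hqn) hm (by simp),
    indexBefore_append_cons fun hm => (List.disjoint_of_nodup_append hpn) hm (by simp),
    ← index_append, ← index_append]
  rw [List.append_cons] at hp hq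
  rw [List.append_cons, List.append_cons q₁] at hu
  have h₁ := isPath_append_cons.1 hp
  have h₂ := isPath_append_cons.1 hq
  rw [hu.sub_eq_index_of_shared hΓ h₁.1 h₁.2 h₂.1 h₂.2 hi₀ he₀]
  push_cast
  rfl

open Classical in
theorem WhiteAt.sum_head {M : Type*} [AddCommMonoid M] [Fintype E] {v : V} {x₁ x₂ x₃ : E}
    (h : Γ.WhiteAt v x₁ x₂ x₃) (c : E → M) :
    ∑ a, (if Γ.head a = .inner v then c a else 0) = c x₃ := by
  rw [Finset.sum_eq_single x₃, if_pos h.isWhite.1]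
  · exact fun a _ ha => if_neg fun ha' => ha (h.eq_of_head a ha')
  · simp

open Classical in
theorem WhiteAt.sum_tail {M : Type*} [AddCommMonoid M] [Fintype E] {v : V} {x₁ x₂ x₃ : E}
    (h : Γ.WhiteAt v x₁ x₂ x₃) (c : E → M) :
    ∑ a, (if Γ.tail a = .inner v then c a else 0) = c x₁ + c x₂ := by
  rw [← Finset.sum_pair h.ne, ← Finset.sum_filter]
  refine Finset.sum_congr (Finset.ext fun a => ?_) fun _ _ => rfl
  simp only [Finset.mem_filter, Finset.mem_univ, true_and, Finset.mem_insert,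
    Finset.mem_singleton]
  exact ⟨h.eq_of_tail a, by rintro (rfl | rfl); exacts [h.tail₁, h.tail₂]⟩

open Classical in
theorem BlackAt.sum_tail {M : Type*} [AddCommMonoid M] [Fintype E] {v : V} {y₁ y₂ y₃ : E}
    (h : Γ.BlackAt v y₁ y₂ y₃) (c : E → M) :
    ∑ a, (if Γ.tail a = .inner v then c a else 0) = c y₃ := by
  rw [Finset.sum_eq_single y₃, if_pos h.isBlack.1]
  · exact fun a _ ha => if_neg fun ha' => ha (h.eq_of_tail a ha')
  · simp

open Classical in
theorem BlackAt.sum_head {M : Type*} [AddCommMonoid M] [Fintype E] {v : V} {y₁ y₂ y₃ : E}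
    (h : Γ.BlackAt v y₁ y₂ y₃) (c : E → M) :
    ∑ a, (if Γ.head a = .inner v then c a else 0) = c y₁ + c y₂ := by
  rw [← Finset.sum_pair h.ne, ← Finset.sum_filter]
  refine Finset.sum_congr (Finset.ext fun a => ?_) fun _ _ => rfl
  simp only [Finset.mem_filter, Finset.mem_univ, true_and, Finset.mem_insert,
    Finset.mem_singleton]
  exact ⟨h.eq_of_head a, by rintro (rfl | rfl); exacts [h.head₁, h.head₂]⟩

variable {k : Type*} [Field k]

variable (Γ) in
open Classical in
/-- The contribution of the pair of edges `x ∈ p`, `y ∈ q` leaving a common vertex. -/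
noncomputable def outTerm (lam mu : k) (p q : List E) (x y : E) : k :=
  if x ∈ p ∧ y ∈ q then
    lam ^ (Γ.index p - (Γ.indexBefore p x - Γ.indexBefore q y)) *
      mu ^ (Γ.index q + (Γ.indexBefore p x - Γ.indexBefore q y)) else 0

variable (Γ) in
open Classical in
/-- The contribution of the pair of edges `x ∈ p`, `y ∈ q` entering a common vertex. -/
noncomputable def inTerm (lam mu : k) (p q : List E) (x y : E) : k :=
  if x ∈ p ∧ y ∈ q then
    lam ^ (Γ.index p - ((Γ.indexBefore p x + Γ.index [x]) -
        (Γ.indexBefore q y + Γ.index [y]))) *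
      mu ^ (Γ.index q + ((Γ.indexBefore p x + Γ.index [x]) -
        (Γ.indexBefore q y + Γ.index [y]))) else 0

open Classical in
theorem WhiteAt.flux_eq [Fintype E] [NeZero (2 : k)] {lam mu : k} (hlam : lam ≠ 0) (hmu : mu ≠ 0)
    (hne : lam ≠ mu) (hΓ : Γ.IsPerfectCylindrical) {v : V} {x₁ x₂ x₃ : E}
    (h : Γ.WhiteAt v x₁ x₂ x₃) {p q : List E} {a b : Fin m} {j l : Fin n}
    (hp : Γ.IsPath (.source a) p (.sink j)) (hq : Γ.IsPath (.source b) q (.sink l))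
    {u : E × Bool → ℚ} (hu : Γ.IsPotential u (pathDiff p q)) {i₀ : Fin m} (hi₀ : i₀.val = 0)
    {e₀ : E} (he₀ : Γ.tail e₀ = .source i₀) {g : E → k} (hg : ∀ e, g e =
      halfStep lam mu (Γ.index p) (Γ.index q) (u (e₀, true) - (u (e, true) + u (e, false)) / 2)) :
    (∑ e, if Γ.head e = .inner v then (if e ∈ p then g e else 0) else 0) -
      (∑ e, if Γ.tail e = .inner v then (if e ∈ p then g e else 0) else 0) =
    1 / 2 * (Γ.outTerm lam mu p q x₁ x₂ - Γ.outTerm lam mu p q x₂ x₁) := by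
  rw [h.sum_head, h.sum_tail]
  have hpn := Γ.nodup_of_isPath hΓ.acyclic hp
  have hqn := Γ.nodup_of_isPath hΓ.acyclic hq
  have ht : Γ.tail x₁ = Γ.tail x₂ := h.tail₁.trans h.tail₂.symm
  have hpx := not_mem_and_mem_of_tail_eq hΓ.acyclic hp h.ne ht
  have hqx := not_mem_and_mem_of_tail_eq hΓ.acyclic hq h.ne ht
  have hp₃ := h.mem_iff hp
  have hq₃ := h.mem_iff hq
  obtain ⟨-, r₁, r₂, r₃⟩ := h.isWhite
  -- The three corners at `v`: the left side of each half-edge is the right side of the next one.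
  have s₁ := hu.rev_rot (x₃, false)
  have s₂ := hu.rev_rot (x₁, true)
  have s₃ := hu.rev_rot (x₂, true)
  rw [r₁] at s₁
  rw [r₂] at s₂
  rw [r₃] at s₃
  change u (x₁, false) = _ at s₁
  change u (x₂, false) = _ at s₂
  change u (x₃, true) = _ at s₃
  have d₁ := hu.sub_eq x₁
  have d₂ := hu.sub_eq x₂
  rw [pathDiff_of_nodup hpn hqn] at d₁ d₂
  unfold outTerm
  by_cases h₁ : x₁ ∈ p
  · have h₂ : x₂ ∉ p := fun h₂ => hpx ⟨h₁, h₂⟩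
    have h₃ : x₃ ∈ p := hp₃.2 (.inl h₁)
    by_cases k₂ : x₂ ∈ q
    · have k₁ : x₁ ∉ q := fun k₁ => hqx ⟨k₁, k₂⟩
      -- The paths separate at `v`. On the common edge `x₃` the level is an integer; the two sides
      -- of `x₁` differ by one, so the mean level moves by one half.
      have hs := index_shared_white hΓ h hp hq hu hi₀ he₀ h₁ k₂ h.tail₁ h.tail₂
      simp only [h₁, h₂, h₃, k₁, k₂, and_self, if_true, if_false, hg, add_zero, sub_zero,
        zero_sub] at d₁ d₂ ⊢
      rw [← halfStep_sub_halfStep_sub hlam hmu hne]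
      congr 2 <;> linarith
    -- Nothing jumps across `x₂`, so `x₃` and `x₁` have the same potential on each side and the flux
    -- vanishes.
    · have e : u (x₃, true) + u (x₃, false) = u (x₁, true) + u (x₁, false) := by
        simp only [h₂, k₂, if_false, sub_zero] at d₂
        linarith
      simp [h₁, h₂, h₃, k₂, hg, e]
  · by_cases h₂ : x₂ ∈ p
    · have h₃ : x₃ ∈ p := hp₃.2 (.inr h₂)
      by_cases k₁ : x₁ ∈ q
      · have k₂ : x₂ ∉ q := fun k₂ => hqx ⟨k₁, k₂⟩
        have hs := index_shared_white hΓ h hp hq hu hi₀ he₀ h₂ k₁ h.tail₂ h.tail₁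
        simp only [h₁, h₂, h₃, k₁, k₂, and_self, if_true, if_false, hg, zero_add, sub_zero,
          zero_sub, mul_neg] at d₁ d₂ ⊢
        rw [← halfStep_sub_halfStep_add hne]
        congr 2 <;> linarith
      · have e : u (x₃, true) + u (x₃, false) = u (x₂, true) + u (x₂, false) := by
          simp only [h₁, k₁, if_false, sub_zero] at d₁
          linarith
        simp [h₁, h₂, h₃, k₁, hg, e]
    · have h₃ : x₃ ∉ p := fun h₃ => (hp₃.1 h₃).elim h₁ h₂
      simp [h₁, h₂, h₃]

open Classical in
theorem BlackAt.flux_eq [Fintype E] [NeZero (2 : k)] {lam mu : k} (hlam : lam ≠ 0) (hmu : mu ≠ 0)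
    (hne : lam ≠ mu) (hΓ : Γ.IsPerfectCylindrical) {v : V} {y₁ y₂ y₃ : E}
    (h : Γ.BlackAt v y₁ y₂ y₃) {p q : List E} {a b : Fin m} {j l : Fin n}
    (hp : Γ.IsPath (.source a) p (.sink j)) (hq : Γ.IsPath (.source b) q (.sink l))
    {u : E × Bool → ℚ} (hu : Γ.IsPotential u (pathDiff p q)) {i₀ : Fin m} (hi₀ : i₀.val = 0)
    {e₀ : E} (he₀ : Γ.tail e₀ = .source i₀) {g : E → k} (hg : ∀ e, g e =
      halfStep lam mu (Γ.index p) (Γ.index q) (u (e₀, true) - (u (e, true) + u (e, false)) / 2)) :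
    (∑ e, if Γ.head e = .inner v then (if e ∈ p then g e else 0) else 0) -
      (∑ e, if Γ.tail e = .inner v then (if e ∈ p then g e else 0) else 0) =
    1 / 2 * (Γ.inTerm lam mu p q y₁ y₂ - Γ.inTerm lam mu p q y₂ y₁) := by
  rw [h.sum_head, h.sum_tail]
  have hpn := Γ.nodup_of_isPath hΓ.acyclic hp
  have hqn := Γ.nodup_of_isPath hΓ.acyclic hq
  have ht : Γ.head y₁ = Γ.head y₂ := h.head₁.trans h.head₂.symm
  have hpx := not_mem_and_mem_of_head_eq hΓ.acyclic hp h.ne ht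
  have hqx := not_mem_and_mem_of_head_eq hΓ.acyclic hq h.ne ht
  have hp₃ := h.mem_iff hp
  have hq₃ := h.mem_iff hq
  obtain ⟨-, r₁, r₂, r₃⟩ := h.isBlack
  have s₁ := hu.rev_rot (y₃, true)
  have s₂ := hu.rev_rot (y₁, false)
  have s₃ := hu.rev_rot (y₂, false)
  rw [r₁] at s₁
  rw [r₂] at s₂
  rw [r₃] at s₃
  change u (y₁, true) = _ at s₁
  change u (y₂, true) = _ at s₂
  change u (y₃, false) = _ at s₃
  have d₁ := hu.sub_eq y₁
  have d₂ := hu.sub_eq y₂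
  rw [pathDiff_of_nodup hpn hqn] at d₁ d₂
  unfold inTerm
  by_cases h₁ : y₁ ∈ p
  · have h₂ : y₂ ∉ p := fun h₂ => hpx ⟨h₁, h₂⟩
    have h₃ : y₃ ∈ p := hp₃.2 (.inl h₁)
    by_cases k₂ : y₂ ∈ q
    · have k₁ : y₁ ∉ q := fun k₁ => hqx ⟨k₁, k₂⟩
      have hs := index_shared_black hΓ h hp hq hu hi₀ he₀ h₁ k₂ h.head₁ h.head₂
      simp only [h₁, h₂, h₃, k₁, k₂, and_self, if_true, if_false, hg, add_zero, sub_zero,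
        zero_sub] at d₁ d₂ ⊢
      rw [← neg_sub, neg_eq_iff_eq_neg, ← halfStep_sub_halfStep_add hne]
      congr 2 <;> linarith
    · have e : u (y₃, true) + u (y₃, false) = u (y₁, true) + u (y₁, false) := by
        simp only [h₂, k₂, if_false, sub_zero] at d₂
        linarith
      simp [h₁, h₂, h₃, k₂, hg, e]
  · by_cases h₂ : y₂ ∈ p
    · have h₃ : y₃ ∈ p := hp₃.2 (.inr h₂)
      by_cases k₁ : y₁ ∈ q
      · have k₂ : y₂ ∉ q := fun k₂ => hqx ⟨k₁, k₂⟩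
        have hs := index_shared_black hΓ h hp hq hu hi₀ he₀ h₂ k₁ h.head₂ h.head₁
        simp only [h₁, h₂, h₃, k₁, k₂, and_self, if_true, if_false, hg, zero_add, sub_zero,
          zero_sub, mul_neg] at d₁ d₂ ⊢
        rw [← halfStep_sub_halfStep_sub hlam hmu hne, neg_sub]
        congr 2 <;> linarith
      · have e : u (y₃, true) + u (y₃, false) = u (y₂, true) + u (y₂, false) := by
          simp only [h₁, k₁, if_false, sub_zero] at d₁
          linarith
        simp [h₁, h₂, h₃, k₁, hg, e]
    · have h₃ : y₃ ∉ p := fun h₃ => (hp₃.1 h₃).elim h₁ h₂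
      simp [h₁, h₂, h₃]

open Classical in
/-- The sum of the local contributions of all vertices is determined by the ends of the paths. -/
theorem sum_localTerms [Fintype V] [Fintype E] [NeZero (2 : k)] {lam mu : k} (hlam : lam ≠ 0)
    (hmu : mu ≠ 0) (hne : lam ≠ mu) (hΓ : Γ.IsPerfectCylindrical) {p q : List E} {a b : Fin m}
    {j l : Fin n} (hp : Γ.IsPath (.source a) p (.sink j))
    (hq : Γ.IsPath (.source b) q (.sink l)) :
    ∑ v : V, ∑ x₁, ∑ x₂, ∑ x₃,
      ((if Γ.IsWhite v x₁ x₂ x₃ then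
          1 / 2 * (Γ.outTerm lam mu p q x₁ x₂ - Γ.outTerm lam mu p q x₂ x₁) else 0) +
        if Γ.IsBlack v x₁ x₂ x₃ then
          1 / 2 * (Γ.inTerm lam mu p q x₁ x₂ - Γ.inTerm lam mu p q x₂ x₁) else 0) =
      trigCoeff lam mu b a * (lam ^ Γ.index p * mu ^ Γ.index q) -
        trigCoeff lam mu l j * (mu ^ Γ.index p * lam ^ Γ.index q) := by
  have hP := hΓ.perfect
  have hE := hΓ.embedded
  have hpn := Γ.nodup_of_isPath hΓ.acyclic hp
  have hqn := Γ.nodup_of_isPath hΓ.acyclic hq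
  obtain ⟨u, hu⟩ := exists_isPotential_pathDiff hP hE hp hq
    (fun X hs ht => by rw [hs a b, ht j l])
  choose s hs hs' using exists_unique_sourceEdge hP
  choose t ht ht' using exists_unique_sinkEdge hP
  let i₀ : Fin m := ⟨0, a.pos⟩
  let j₀ : Fin n := ⟨0, j.pos⟩
  -- The level is measured from the face where the cut starts and averaged over the two sides of the
  -- edge.
  let g : E → k := fun e => halfStep lam mu (Γ.index p) (Γ.index q)
    (u (s i₀, true) - (u (e, true) + u (e, false)) / 2)
  have hflux := sum_flux hP hp (hs a) (ht j) g
  refine (Finset.sum_congr rfl fun v _ => ?_).trans (hflux.trans ?_)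
  · rcases whiteAt_or_blackAt hP hE v with ⟨x₁, x₂, x₃, h⟩ | ⟨x₁, x₂, x₃, h⟩
    · exact (h.sum_eq
        (fun x₁ x₂ _ => 1 / 2 * (Γ.outTerm lam mu p q x₁ x₂ - Γ.outTerm lam mu p q x₂ x₁))
        (fun x₁ x₂ _ => 1 / 2 * (Γ.inTerm lam mu p q x₁ x₂ - Γ.inTerm lam mu p q x₂ x₁))).trans
        (h.flux_eq hlam hmu hne hΓ hp hq hu (i₀ := i₀) rfl (hs i₀) fun _ => rfl).symm
    · exact (h.sum_eq
        (fun x₁ x₂ _ => 1 / 2 * (Γ.outTerm lam mu p q x₁ x₂ - Γ.outTerm lam mu p q x₂ x₁))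
        (fun x₁ x₂ _ => 1 / 2 * (Γ.inTerm lam mu p q x₁ x₂ - Γ.inTerm lam mu p q x₂ x₁))).trans
        (h.flux_eq hlam hmu hne hΓ hp hq hu (i₀ := i₀) rfl (hs i₀) fun _ => rfl).symm
  congr 1
  -- At the sources the reference level is `h = 0`.
  · have h := sub_mean_of_rec (x := fun i => u (s i, true)) (y := fun i => u (s i, false))
      (i₀ := i₀) (a := a) (b := b) rfl (fun i i' hi => by
        have h : Γ.base (Γ.rot (s i', true)) = .source i := by
          rw [hE.rot_source (s i', true) i' (hs i'), ← finRotate_eq_of_val hi, Equiv.symm_apply_apply]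
        have h' := hu.rev_rot (s i', true)
        rw [hs' i _ h] at h'
        exact h'.symm) (fun i => by
        rw [hu.sub_eq, pathDiff_of_nodup hpn hqn]
        simp only [mem_iff_of_tail_source hP hp (hs i), mem_iff_of_tail_source hP hq (hs i)])
    refine (halfStep_eq_trigCoeff hlam hmu (Γ.index p) (Γ.index q) 0 b a ?_).trans (by simp)
    push_cast
    linarith
  · have h := sub_mean_of_rec (x := fun i => u (t i, true)) (y := fun i => u (t i, false))
      (i₀ := j₀) (a := j) (b := l) rfl (fun i i' hi => by
        have h := hE.rot_sink (t i, false) i (ht i)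
        rw [finRotate_eq_of_val hi] at h
        have h' := hu.rev_rot (t i, false)
        rw [ht' i' _ h] at h'
        exact h') (fun i => by
        rw [hu.sub_eq, pathDiff_of_nodup hpn hqn]
        simp only [mem_iff_of_head_sink hP hp (ht i), mem_iff_of_head_sink hP hq (ht i)])
    -- The top sink is at the other end of the cut, which shifts the level by `h = d(p) - d(q)` and
    -- so exchanges the exponents of `lam` and `mu`.
    have hcut := hu.sub_eq_index hΓ.cut (i := i₀) (j := j₀) rfl rfl (hs i₀) (ht j₀)
    refine (halfStep_eq_trigCoeff hlam hmu (Γ.index p) (Γ.index q) (Γ.index p - Γ.index q)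
      l j ?_).trans (by rw [sub_sub_cancel, add_sub_cancel, mul_comm (lam ^ _)])
    push_cast
    linarith

end Flux

end CylNetwork

namespace CylNetwork

variable {m n : ℕ} {V E : Type*} {Γ : CylNetwork m n V E} {k : Type*} [Field k]

/-! ### Sums over paths -/

section Paths

variable [Finite E] (hΓ : Γ.IsAcyclic)

/-- The finite set of paths between two vertices. -/
noncomputable def paths (a b : NetVertex m n V) : Finset (List E) :=
  (Γ.finite_isPath hΓ a b).toFinset

theorem mem_paths {a b : NetVertex m n V} {p : List E} : p ∈ paths hΓ a b ↔ Γ.IsPath a p b := by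
  simp [paths]

theorem paths_self (a : NetVertex m n V) : paths hΓ a a = {[]} := by
  ext p
  rw [mem_paths, Finset.mem_singleton]
  exact ⟨hΓ a p, by rintro rfl; rfl⟩

open Classical in
/-- A path through an edge consists of a path to its tail and a path from its head. -/
theorem sum_paths_through {M : Type*} [AddCommMonoid M] (e : E) (a b : NetVertex m n V)
    (F : List E → M) :
    ∑ q ∈ paths hΓ a (Γ.tail e), ∑ r ∈ paths hΓ (Γ.head e) b, F (q ++ e :: r) =
      ∑ p ∈ paths hΓ a b, if e ∈ p then F p else 0 := by
  have nm : ∀ {q r : List E}, q ∈ paths hΓ a (Γ.tail e) → r ∈ paths hΓ (Γ.head e) b → e ∉ q := by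
    intro q r hq hr he
    rw [mem_paths] at hq hr
    have := Γ.nodup_of_isPath hΓ (isPath_append_cons.2 ⟨hq, hr⟩)
    exact List.disjoint_of_nodup_append this he (by simp)
  rw [← Finset.sum_product', ← Finset.sum_filter]
  refine Finset.sum_bij (fun x _ => x.1 ++ e :: x.2) ?_ ?_ ?_ ?_
  · rintro ⟨q, r⟩ h
    rw [Finset.mem_product, mem_paths, mem_paths] at h
    rw [Finset.mem_filter, mem_paths]
    exact ⟨isPath_append_cons.2 h, by simp⟩
  · rintro ⟨q, r⟩ h ⟨q', r'⟩ h' heq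
    rw [Finset.mem_product] at h h'
    have hq := nm h.1 h.2
    have hq' := nm h'.1 h'.2
    have tw : ∀ {s t : List E}, e ∉ s → (s ++ e :: t).takeWhile (fun f => f ≠ e) = s := by
      intro s t hs
      rw [List.takeWhile_append_of_pos]
      · simp
      · intro f hf
        simp only [ne_eq, decide_not, Bool.not_eq_eq_eq_not, Bool.not_true,
          decide_eq_false_iff_not]
        rintro rfl
        exact hs hf
    have h₁ : q = q' := by
      have := congrArg (List.takeWhile fun f => f ≠ e) heq
      simpa only [tw hq, tw hq'] using this
    subst h₁
    simpa using heq
  · intro p hp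
    rw [Finset.mem_filter, mem_paths] at hp
    obtain ⟨q, r, rfl⟩ := List.append_of_mem hp.2
    have := isPath_append_cons.1 hp.1
    exact ⟨(q, r), by rw [Finset.mem_product, mem_paths, mem_paths]; exact this, rfl⟩
  · intro _ _; rfl

end Paths

/-! ### The category of paths -/

section Algebra

variable [Fintype V]

theorem idAt_mul_idAt (a : NetVertex m n V) : Γ.idAt k a * Γ.idAt k a = Γ.idAt k a := by
  simpa only [map_mul, idAt] using Γ.toAlg_rel (k := k) (.one_mul_one a)

theorem idAt_tail_mul_arr (e : E) : Γ.idAt k (Γ.tail e) * Γ.arr k e = Γ.arr k e := by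
  simpa only [map_mul, idAt, arr] using Γ.toAlg_rel (k := k) (.one_mul_edge e)

theorem arr_mul_idAt_head (e : E) : Γ.arr k e * Γ.idAt k (Γ.head e) = Γ.arr k e := by
  simpa only [map_mul, idAt, arr] using Γ.toAlg_rel (k := k) (.edge_mul_one e)

theorem weight_nil : (Γ.weight [] : Γ.PathAlg k) = 1 := rfl

theorem weight_cons (e : E) (p : List E) :
    (Γ.weight (e :: p) : Γ.PathAlg k) = Γ.arr k e * Γ.weight p := by
  simp [weight]

theorem weight_append (p q : List E) :
    (Γ.weight (p ++ q) : Γ.PathAlg k) = Γ.weight p * Γ.weight q := by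
  simp [weight]

/-- The empty path has weight `1` rather than an identity morphism, so neither side can be shortened
to the weight itself. -/
theorem idAt_mul_weight {p : List E} : ∀ {a b : NetVertex m n V}, Γ.IsPath a p b →
    Γ.idAt k a * Γ.weight p = Γ.weight p * Γ.idAt k b := by
  induction p with
  | nil => rintro a b rfl; rw [weight_nil, one_mul, mul_one]
  | cons e p ih =>
    rintro a b ⟨rfl, h⟩
    rw [weight_cons, ← mul_assoc, idAt_tail_mul_arr, mul_assoc, ← ih h, ← mul_assoc,
      arr_mul_idAt_head]

theorem idAt_mul_weight_of_mem {p : List E} {a b : NetVertex m n V} (h : Γ.IsPath a p b) {e : E}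
    (he : e ∈ p) : Γ.idAt k a * Γ.weight p = Γ.weight p := by
  cases p with
  | nil => simp at he
  | cons f p => obtain ⟨rfl, -⟩ := h; rw [weight_cons, ← mul_assoc, idAt_tail_mul_arr]

theorem partialHom_arr (e f : E) : Γ.partialHom k e (Γ.arr k f) = Γ.partialGen k e (.edge f) := by
  have : Γ.partialHom k e (Γ.arr k f) =
      FreeAlgebra.lift k (Γ.partialGen k e) (FreeAlgebra.ι k (.edge f)) :=
    RingQuot.liftAlgHom_mkAlgHom_apply k _ _ _
  rw [this, FreeAlgebra.lift_ι_apply]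

theorem partialHom_weight (e : E) (p : List E) :
    Γ.partialHom k e (Γ.weight p) 1 0 = 0 ∧
      Γ.partialHom k e (Γ.weight p) 1 1 = 1 ⊗ₜ Γ.weight p := by
  induction p with
  | nil => rw [weight_nil, map_one]; simp [Algebra.TensorProduct.one_def]
  | cons f p ih =>
    rw [weight_cons, map_mul, partialHom_arr]
    constructor
    · simp [Matrix.mul_apply, Fin.sum_univ_two, partialGen, ih.1]
    · simp [Matrix.mul_apply, Fin.sum_univ_two, partialGen, ih.2]

open Classical in
theorem partialD_weight_cons (e f : E) (p : List E) :
    Γ.partialD k e (Γ.weight (f :: p)) = (Γ.arr k f ⊗ₜ 1) * Γ.partialD k e (Γ.weight p) +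
      (if f = e then Γ.idAt k (Γ.tail f) ⊗ₜ (Γ.idAt k (Γ.head f) * Γ.weight p) else 0) := by
  change Γ.partialHom k e (Γ.weight (f :: p)) 0 1 =
    _ * Γ.partialHom k e (Γ.weight p) 0 1 + _
  rw [weight_cons, map_mul, partialHom_arr, Matrix.mul_apply, Fin.sum_univ_two,
    (partialHom_weight e p).2]
  by_cases h : f = e <;> simp [partialGen, h]

theorem partialD_weight_nil (e : E) : Γ.partialD k e (Γ.weight []) = 0 := by
  change Γ.partialHom k e (Γ.weight []) 0 1 = 0
  rw [weight_nil, map_one]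
  rfl

theorem partialD_weight_of_not_mem {e : E} {p : List E} (h : e ∉ p) :
    Γ.partialD k e (Γ.weight p) = 0 := by
  induction p with
  | nil => exact partialD_weight_nil e
  | cons f p ih =>
    rw [List.mem_cons, not_or] at h
    rw [partialD_weight_cons, ih h.2, if_neg (Ne.symm h.1), mul_zero, add_zero]

theorem partialD_weight_append_cons {e : E} {q r : List E} (hq : e ∉ q) (hr : e ∉ r) :
    Γ.partialD k e (Γ.weight (q ++ e :: r)) =
      (Γ.weight q * Γ.idAt k (Γ.tail e)) ⊗ₜ (Γ.idAt k (Γ.head e) * Γ.weight r) := by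
  induction q with
  | nil =>
    rw [List.nil_append, partialD_weight_cons, partialD_weight_of_not_mem hr, mul_zero, zero_add,
      if_pos rfl, weight_nil, one_mul]
  | cons f q ih =>
    rw [List.mem_cons, not_or] at hq
    rw [List.cons_append, partialD_weight_cons, if_neg (Ne.symm hq.1), ih hq.2, add_zero,
      Algebra.TensorProduct.tmul_mul_tmul, one_mul, weight_cons, mul_assoc]

theorem sandwich_tmul (c : Γ.PathAlg k ⊗[k] Γ.PathAlg k) (x y z t : Γ.PathAlg k) :
    Γ.sandwich c ((x ⊗ₜ y) ⊗ₜ (z ⊗ₜ t)) = (z ⊗ₜ x) * c * (y ⊗ₜ t) := by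
  simp [sandwich, tau]

variable [Finite E] (hΓ : Γ.IsAcyclic)

theorem boundaryMeasurement_eq_sum (z : k) (i : Fin m) (j : Fin n) :
    Γ.boundaryMeasurement z i j =
      ∑ p ∈ paths hΓ (.source i) (.sink j), z ^ Γ.index p • Γ.weight p :=
  finsum_mem_eq_finite_toFinset_sum _ (Γ.finite_isPath hΓ _ _)

/-- The generating function of the paths between two vertices. -/
noncomputable def pathSum (z : k) (a b : NetVertex m n V) : Γ.PathAlg k :=
  ∑ p ∈ paths hΓ a b, z ^ Γ.index p • (Γ.idAt k a * Γ.weight p)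

theorem idAt_mul_pathSum (z : k) (a b : NetVertex m n V) :
    Γ.idAt k a * pathSum hΓ z a b = pathSum hΓ z a b := by
  simp only [pathSum, Finset.mul_sum, mul_smul_comm, ← mul_assoc, idAt_mul_idAt]

theorem pathSum_mul_idAt (z : k) (a b : NetVertex m n V) :
    pathSum hΓ z a b * Γ.idAt k b = pathSum hΓ z a b := by
  simp only [pathSum, Finset.sum_mul, smul_mul_assoc]
  refine Finset.sum_congr rfl fun p hp => ?_
  rw [idAt_mul_weight ((mem_paths hΓ).1 hp), mul_assoc, idAt_mul_idAt]

/-- This is the purpose of the factor `idAt` in `pathSum`: it makes the empty path count as the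
identity of its vertex. -/
theorem pathSum_self (z : k) (a : NetVertex m n V) : pathSum hΓ z a a = Γ.idAt k a := by
  rw [pathSum, paths_self, Finset.sum_singleton, index_nil, zpow_zero, one_smul, weight_nil,
    mul_one]

/-- By acyclicity a path contains `e` at most once, so `∂_e` cuts it into a path to the tail of `e`
and a path from its head, and these two parts vary independently. -/
theorem partialD_boundaryMeasurement {z : k} (hz : z ≠ 0) (e : E) (i : Fin m) (j : Fin n) :
    Γ.partialD k e (Γ.boundaryMeasurement z i j) = z ^ Γ.index [e] •
      pathSum hΓ z (.source i) (Γ.tail e) ⊗ₜ[k] pathSum hΓ z (Γ.head e) (.sink j) := by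
  classical
  rw [boundaryMeasurement_eq_sum hΓ, map_sum, pathSum, pathSum, TensorProduct.sum_tmul,
    Finset.smul_sum]
  simp only [TensorProduct.tmul_sum, Finset.smul_sum, map_smul]
  have h₁ : ∀ p ∈ paths hΓ (.source i) (.sink j),
      z ^ Γ.index p • Γ.partialD k e (Γ.weight p) =
        if e ∈ p then z ^ Γ.index p • Γ.partialD k e (Γ.weight p) else 0 := fun p _ => by
    split_ifs with h
    · rfl
    · rw [partialD_weight_of_not_mem h, smul_zero]
  rw [Finset.sum_congr rfl h₁, ← sum_paths_through]
  refine Finset.sum_congr rfl fun q hq => Finset.sum_congr rfl fun r hr => ?_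
  rw [mem_paths] at hq hr
  have hn := Γ.nodup_of_isPath hΓ (isPath_append_cons.2 ⟨hq, hr⟩)
  have he : e ∉ q := fun h => List.disjoint_of_nodup_append hn h (by simp)
  have he' : e ∉ r := (List.nodup_cons.1 (List.Nodup.of_append_right hn)).1
  rw [partialD_weight_append_cons he he', ← idAt_mul_weight hq, TensorProduct.smul_tmul_smul,
    smul_smul, index_append, index_cons, zpow_add₀ hz, zpow_add₀ hz]
  congr 1
  ring

open Classical in
-- Two parameters occur because the exchange of final parts glues an initial part counted with one
-- spectral parameter to a final part counted with the other.
theorem pathSum_mul_arr_mul_pathSum (z t : k) (e : E) (a b : NetVertex m n V) :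
    pathSum hΓ t a (Γ.tail e) * Γ.arr k e * pathSum hΓ z (Γ.head e) b =
      ∑ p ∈ paths hΓ a b, if e ∈ p then
        (t ^ Γ.indexBefore p e * z ^ (Γ.index p - Γ.indexBefore p e - Γ.index [e])) • Γ.weight p
      else 0 := by
  rw [← sum_paths_through hΓ e a b fun p =>
    (t ^ Γ.indexBefore p e * z ^ (Γ.index p - Γ.indexBefore p e - Γ.index [e])) • Γ.weight p]
  simp only [pathSum, Finset.sum_mul, Finset.mul_sum]
  rw [Finset.sum_comm]
  refine Finset.sum_congr rfl fun q hq => Finset.sum_congr rfl fun r hr => ?_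
  rw [mem_paths] at hq hr
  have hp := isPath_append_cons.2 ⟨hq, hr⟩
  have hn := Γ.nodup_of_isPath hΓ hp
  have he : e ∉ q := fun h => List.disjoint_of_nodup_append hn h (by simp)
  rw [indexBefore_append_cons he, smul_mul_assoc, smul_mul_assoc, mul_smul_comm, smul_smul,
    index_append, index_cons e r]
  congr 1
  · congr 2
    ring
  · rw [mul_assoc, ← mul_assoc (Γ.arr k e), arr_mul_idAt_head, mul_assoc, ← weight_cons,
      ← weight_append, idAt_mul_weight_of_mem hp (e := e) (by simp)]

open Classical in
theorem pathSum_mul_arr {z : k} (hz : z ≠ 0) (e : E) (a : NetVertex m n V) :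
    z ^ Γ.index [e] • (pathSum hΓ z a (Γ.tail e) * Γ.arr k e) =
      ∑ p ∈ paths hΓ a (Γ.head e), if e ∈ p then z ^ Γ.index p • (Γ.idAt k a * Γ.weight p)
        else 0 := by
  have h := pathSum_mul_arr_mul_pathSum hΓ z z e a (Γ.head e)
  rw [pathSum_self, mul_assoc, arr_mul_idAt_head] at h
  rw [h, Finset.smul_sum]
  refine Finset.sum_congr rfl fun p hp => ?_
  split_ifs with he
  · rw [smul_smul, ← zpow_add₀ hz, ← zpow_add₀ hz,
      idAt_mul_weight_of_mem ((mem_paths hΓ).1 hp) he]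
    congr 2
    ring
  · rw [smul_zero]

open Classical in
theorem arr_mul_pathSum {z : k} (hz : z ≠ 0) (e : E) (b : NetVertex m n V) :
    z ^ Γ.index [e] • (Γ.arr k e * pathSum hΓ z (Γ.head e) b) =
      ∑ p ∈ paths hΓ (Γ.tail e) b, if e ∈ p then
        z ^ Γ.index p • (Γ.idAt k (Γ.tail e) * Γ.weight p) else 0 := by
  have h := pathSum_mul_arr_mul_pathSum hΓ z z e (Γ.tail e) b
  rw [pathSum_self, idAt_tail_mul_arr] at h
  rw [h, Finset.smul_sum]
  refine Finset.sum_congr rfl fun p hp => ?_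
  split_ifs with he
  · rw [smul_smul, ← zpow_add₀ hz, ← zpow_add₀ hz,
      idAt_mul_weight_of_mem ((mem_paths hΓ).1 hp) he]
    congr 2
    ring
  · rw [smul_zero]

theorem pathSum_eq_of_mem_head {z : k} (hz : z ≠ 0) {a b : NetVertex m n V} {e : E}
    (hb : Γ.head e = b) (h : ∀ p, Γ.IsPath a p b → e ∈ p) :
    pathSum hΓ z a b = z ^ Γ.index [e] • (pathSum hΓ z a (Γ.tail e) * Γ.arr k e) := by
  subst hb
  rw [pathSum_mul_arr hΓ hz]
  exact Finset.sum_congr rfl fun p hp => (if_pos (h p ((mem_paths hΓ).1 hp))).symm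

theorem pathSum_eq_of_mem_tail {z : k} (hz : z ≠ 0) {a b : NetVertex m n V} {e : E}
    (ha : Γ.tail e = a) (h : ∀ p, Γ.IsPath a p b → e ∈ p) :
    pathSum hΓ z a b = z ^ Γ.index [e] • (Γ.arr k e * pathSum hΓ z (Γ.head e) b) := by
  subst ha
  rw [arr_mul_pathSum hΓ hz]
  exact Finset.sum_congr rfl fun p hp => (if_pos (h p ((mem_paths hΓ).1 hp))).symm

theorem pathSum_eq_add_head {z : k} (hz : z ≠ 0) {a b : NetVertex m n V} {e f : E}
    (he : Γ.head e = b) (hf : Γ.head f = b) (hef : e ≠ f)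
    (h : ∀ p, Γ.IsPath a p b → e ∈ p ∨ f ∈ p) :
    pathSum hΓ z a b = z ^ Γ.index [e] • (pathSum hΓ z a (Γ.tail e) * Γ.arr k e) +
      z ^ Γ.index [f] • (pathSum hΓ z a (Γ.tail f) * Γ.arr k f) := by
  rw [pathSum_mul_arr hΓ hz, pathSum_mul_arr hΓ hz, he, hf, ← Finset.sum_add_distrib]
  refine Finset.sum_congr rfl fun p hp => ?_
  rw [mem_paths] at hp
  have hn := not_mem_and_mem_of_head_eq hΓ hp hef (he.trans hf.symm)
  rcases h p hp with h | h
  · rw [if_pos h, if_neg fun h' => hn ⟨h, h'⟩, add_zero]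
  · rw [if_pos h, if_neg fun h' => hn ⟨h', h⟩, zero_add]

theorem pathSum_eq_add_tail {z : k} (hz : z ≠ 0) {a b : NetVertex m n V} {e f : E}
    (he : Γ.tail e = a) (hf : Γ.tail f = a) (hef : e ≠ f)
    (h : ∀ p, Γ.IsPath a p b → e ∈ p ∨ f ∈ p) :
    pathSum hΓ z a b = z ^ Γ.index [e] • (Γ.arr k e * pathSum hΓ z (Γ.head e) b) +
      z ^ Γ.index [f] • (Γ.arr k f * pathSum hΓ z (Γ.head f) b) := by
  rw [arr_mul_pathSum hΓ hz, arr_mul_pathSum hΓ hz, he, hf, ← Finset.sum_add_distrib]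
  refine Finset.sum_congr rfl fun p hp => ?_
  rw [mem_paths] at hp
  have hn := not_mem_and_mem_of_tail_eq hΓ hp hef (he.trans hf.symm)
  rcases h p hp with h | h
  · rw [if_pos h, if_neg fun h' => hn ⟨h, h'⟩, add_zero]
  · rw [if_pos h, if_neg fun h' => hn ⟨h', h⟩, zero_add]

end Algebra

end CylNetwork

namespace CylNetwork

variable {m n : ℕ} {V E : Type*} {Γ : CylNetwork m n V E} {k : Type*} [Field k]
  [Fintype V]

/-! ### The double bracket as a sum over vertices -/

theorem tau_tmul (x y : Γ.PathAlg k) : Γ.tau k (x ⊗ₜ y) = y ⊗ₜ x := rfl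

/-- The linear map `c ↦ r (x ⊗ x') c (y ⊗ y')`. -/
noncomputable def dress (r : k) (x x' y y' : Γ.PathAlg k) :
    Γ.PathAlg k ⊗[k] Γ.PathAlg k →ₗ[k] Γ.PathAlg k ⊗[k] Γ.PathAlg k :=
  r • (LinearMap.mulRight k (y ⊗ₜ y') ∘ₗ LinearMap.mulLeft k (x ⊗ₜ[k] x'))

theorem dress_tmul (r : k) (x x' y y' c c' : Γ.PathAlg k) :
    dress r x x' y y' (c ⊗ₜ c') = r • ((x * c * y) ⊗ₜ (x' * c' * y')) := by
  simp [dress]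

variable [Fintype E]

open Classical in
theorem edgeBracket_eq_sum (w : Weights k) : Γ.edgeBracket w =
    ∑ v : V, ∑ x₁ : E, ∑ x₂ : E, ∑ x₃ : E,
    ((if Γ.IsWhite v x₁ x₂ x₃ then
        Γ.pairTerm x₁ x₂ (w.w₁₂ • Γ.arr k x₁ ⊗ₜ Γ.arr k x₂) +
        Γ.pairTerm x₁ x₃ (w.w₁₃ • (Γ.arr k x₃ * Γ.arr k x₁) ⊗ₜ Γ.idAt k (.inner v)) +
        Γ.pairTerm x₂ x₃ (w.w₂₃ • (Γ.arr k x₃ * Γ.arr k x₂) ⊗ₜ Γ.idAt k (.inner v))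
      else 0) +
     (if Γ.IsBlack v x₁ x₂ x₃ then
        Γ.pairTerm x₁ x₂ (w.b₁₂ • Γ.arr k x₂ ⊗ₜ Γ.arr k x₁) +
        Γ.pairTerm x₁ x₃ (w.b₁₃ • Γ.idAt k (.inner v) ⊗ₜ (Γ.arr k x₁ * Γ.arr k x₃)) +
        Γ.pairTerm x₂ x₃ (w.b₂₃ • Γ.idAt k (.inner v) ⊗ₜ (Γ.arr k x₂ * Γ.arr k x₃))
      else 0)) := by
  have ite_app : ∀ (P : Prop) [Decidable P] (F : E → E → Γ.PathAlg k ⊗[k] Γ.PathAlg k) (e f : E),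
      (if P then F else 0) e f = if P then F e f else 0 := by
    intro P _ F e f
    split_ifs <;> rfl
  ext e f
  simp only [edgeBracket, Finset.sum_apply, Pi.add_apply, ite_app]

/-- The linear functional on functions of two edges given by a family of linear maps. -/
noncomputable def pairSum {M T : Type*} [AddCommMonoid M] [Module k M] [AddCommMonoid T]
    [Module k T] (Φ : E → E → T →ₗ[k] M) : (E → E → T) →ₗ[k] M :=
  ∑ e, ∑ f, Φ e f ∘ₗ LinearMap.proj f ∘ₗ LinearMap.proj e

theorem pairSum_apply {M T : Type*} [AddCommMonoid M] [Module k M] [AddCommMonoid T]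
    [Module k T] (Φ : E → E → T →ₗ[k] M) (X : E → E → T) :
    pairSum Φ X = ∑ e, ∑ f, Φ e f (X e f) := by
  simp [pairSum, LinearMap.sum_apply]

theorem pairSum_pairTerm {M : Type*} [AddCommGroup M] [Module k M]
    (Φ : E → E → Γ.PathAlg k ⊗[k] Γ.PathAlg k →ₗ[k] M) (a b : E)
    (c : Γ.PathAlg k ⊗[k] Γ.PathAlg k) :
    pairSum Φ (Γ.pairTerm a b c) = Φ a b c - Φ b a (Γ.tau k c) := by
  classical
  have h : ∀ (a b : E) (c : Γ.PathAlg k ⊗[k] Γ.PathAlg k),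
      ∑ e, ∑ f, Φ e f (if e = a ∧ f = b then c else 0) = Φ a b c := by
    intro a b c
    rw [Finset.sum_eq_single a, Finset.sum_eq_single b, if_pos ⟨rfl, rfl⟩]
    · exact fun f _ hf => by rw [if_neg fun h => hf h.2, map_zero]
    · simp
    · exact fun e _ he => Finset.sum_eq_zero fun f _ => by rw [if_neg fun h => he h.1, map_zero]
    · simp
  rw [pairSum_apply, ← h a b c, ← h b a, ← Finset.sum_sub_distrib]
  refine Finset.sum_congr rfl fun e _ => ?_
  rw [← Finset.sum_sub_distrib]
  refine Finset.sum_congr rfl fun f _ => ?_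
  unfold pairTerm
  rw [map_sub]

/-- The exchange of ends becomes visible here: the first tensor factor starts at `a` with parameter
`mu` and ends at `j` with parameter `lam`, the second runs from `b` to `l` with the parameters
reversed. -/
theorem doubleBracket_boundaryMeasurement (hΓ : Γ.IsAcyclic) (w : Weights k) {lam mu : k}
    (hlam : lam ≠ 0) (hmu : mu ≠ 0) (a b : Fin m) (j l : Fin n) :
    Γ.doubleBracket w (Γ.boundaryMeasurement lam b j) (Γ.boundaryMeasurement mu a l) =
      pairSum (fun e f => dress (lam ^ Γ.index [e] * mu ^ Γ.index [f])
        (pathSum hΓ mu (.source a) (Γ.tail f)) (pathSum hΓ lam (.source b) (Γ.tail e))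
        (pathSum hΓ lam (Γ.head e) (.sink j)) (pathSum hΓ mu (Γ.head f) (.sink l)))
        (Γ.edgeBracket w) := by
  rw [pairSum_apply]
  unfold doubleBracket
  refine Finset.sum_congr rfl fun e _ => Finset.sum_congr rfl fun f _ => ?_
  rw [partialD_boundaryMeasurement hΓ hlam, partialD_boundaryMeasurement hΓ hmu,
    TensorProduct.smul_tmul_smul, map_smul, sandwich_tmul]
  rfl

/-- The bracket at a white vertex. -/
theorem white_bracket (w : Weights k) (hΓ : Γ.IsAcyclic) {v : V} {x₁ x₂ x₃ : E}
    (h : Γ.WhiteAt v x₁ x₂ x₃) {lam mu : k} (hlam : lam ≠ 0) (hmu : mu ≠ 0) (a b : Fin m)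
    (j l : Fin n) {Φ : E → E → Γ.PathAlg k ⊗[k] Γ.PathAlg k →ₗ[k] Γ.PathAlg k ⊗[k] Γ.PathAlg k}
    (hΦ : ∀ e f, Φ e f = dress (lam ^ Γ.index [e] * mu ^ Γ.index [f])
        (pathSum hΓ mu (.source a) (Γ.tail f)) (pathSum hΓ lam (.source b) (Γ.tail e))
        (pathSum hΓ lam (Γ.head e) (.sink j)) (pathSum hΓ mu (Γ.head f) (.sink l))) :
    pairSum Φ (Γ.pairTerm x₁ x₂ (w.w₁₂ • Γ.arr k x₁ ⊗ₜ Γ.arr k x₂) +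
        Γ.pairTerm x₁ x₃ (w.w₁₃ • (Γ.arr k x₃ * Γ.arr k x₁) ⊗ₜ Γ.idAt k (.inner v)) +
        Γ.pairTerm x₂ x₃ (w.w₂₃ • (Γ.arr k x₃ * Γ.arr k x₂) ⊗ₜ Γ.idAt k (.inner v))) =
      (w.w₁₂ + w.w₁₃ - w.w₂₃) •
        (Φ x₁ x₂ (Γ.arr k x₁ ⊗ₜ Γ.arr k x₂) - Φ x₂ x₁ (Γ.arr k x₂ ⊗ₜ Γ.arr k x₁)) := by
  -- Every path into `v` arrives by `x₃`, every path out of it leaves by `x₁` or `x₂`. After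
  -- expansion, the terms of the `w₁₃` and `w₂₃` pairs in which both factors leave by the same edge
  -- cancel by skew-symmetry; the rest is the `w₁₂` expression, with sign `+` and `-` respectively.
  have hin : ∀ {z : k}, z ≠ 0 → ∀ i : Fin m, pathSum hΓ z (.source i) (.inner v) =
      z ^ Γ.index [x₃] • (pathSum hΓ z (.source i) (Γ.tail x₃) * Γ.arr k x₃) := fun hz i =>
    pathSum_eq_of_mem_head hΓ hz h.isWhite.1 fun p hp => by
      rcases List.eq_nil_or_concat p with rfl | ⟨q, e, rfl⟩
      · cases hp
      · rw [List.concat_eq_append] at hp ⊢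
        rw [h.eq_of_head e (isPath_append_cons.1 hp).2]
        simp
  have hout : ∀ {z : k}, z ≠ 0 → ∀ i : Fin n, pathSum hΓ z (.inner v) (.sink i) =
      z ^ Γ.index [x₁] • (Γ.arr k x₁ * pathSum hΓ z (Γ.head x₁) (.sink i)) +
      z ^ Γ.index [x₂] • (Γ.arr k x₂ * pathSum hΓ z (Γ.head x₂) (.sink i)) := fun hz i =>
    pathSum_eq_add_tail hΓ hz h.tail₁ h.tail₂ h.ne fun p hp => by
      cases p with
      | nil => cases hp
      | cons e p => rcases h.eq_of_tail e hp.1 with rfl | rfl <;> simp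
  have hid := fun (z : k) (c : NetVertex m n V) => pathSum_mul_idAt hΓ z c (.inner v)
  simp only [map_add, pairSum_pairTerm, map_smul, tau_tmul, hΦ, dress_tmul, h.tail₁, h.tail₂,
    h.isWhite.1, hid]
  simp only [hin hlam, hin hmu, hout hlam, hout hmu, mul_add, smul_mul_assoc, mul_smul_comm,
    TensorProduct.tmul_add, TensorProduct.add_tmul, ← TensorProduct.smul_tmul',
    TensorProduct.tmul_smul, smul_smul, smul_add, mul_assoc]
  module

/-- The bracket at a black vertex. -/
theorem black_bracket (w : Weights k) (hΓ : Γ.IsAcyclic) {v : V} {y₁ y₂ y₃ : E}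
    (h : Γ.BlackAt v y₁ y₂ y₃) {lam mu : k} (hlam : lam ≠ 0) (hmu : mu ≠ 0) (a b : Fin m)
    (j l : Fin n) {Φ : E → E → Γ.PathAlg k ⊗[k] Γ.PathAlg k →ₗ[k] Γ.PathAlg k ⊗[k] Γ.PathAlg k}
    (hΦ : ∀ e f, Φ e f = dress (lam ^ Γ.index [e] * mu ^ Γ.index [f])
        (pathSum hΓ mu (.source a) (Γ.tail f)) (pathSum hΓ lam (.source b) (Γ.tail e))
        (pathSum hΓ lam (Γ.head e) (.sink j)) (pathSum hΓ mu (Γ.head f) (.sink l))) :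
    pairSum Φ (Γ.pairTerm y₁ y₂ (w.b₁₂ • Γ.arr k y₂ ⊗ₜ Γ.arr k y₁) +
        Γ.pairTerm y₁ y₃ (w.b₁₃ • Γ.idAt k (.inner v) ⊗ₜ (Γ.arr k y₁ * Γ.arr k y₃)) +
        Γ.pairTerm y₂ y₃ (w.b₂₃ • Γ.idAt k (.inner v) ⊗ₜ (Γ.arr k y₂ * Γ.arr k y₃))) =
      (w.b₁₂ + w.b₁₃ - w.b₂₃) •
        (Φ y₁ y₂ (Γ.arr k y₂ ⊗ₜ Γ.arr k y₁) - Φ y₂ y₁ (Γ.arr k y₁ ⊗ₜ Γ.arr k y₂)) := by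
  -- The mirror image of the white case: paths enter by `y₁` or `y₂` and all leave by `y₃`.
  have hout : ∀ {z : k}, z ≠ 0 → ∀ i : Fin n, pathSum hΓ z (.inner v) (.sink i) =
      z ^ Γ.index [y₃] • (Γ.arr k y₃ * pathSum hΓ z (Γ.head y₃) (.sink i)) := fun hz i =>
    pathSum_eq_of_mem_tail hΓ hz h.isBlack.1 fun p hp => by
      cases p with
      | nil => cases hp
      | cons e p => rw [h.eq_of_tail e hp.1]; simp
  have hin : ∀ {z : k}, z ≠ 0 → ∀ i : Fin m, pathSum hΓ z (.source i) (.inner v) =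
      z ^ Γ.index [y₁] • (pathSum hΓ z (.source i) (Γ.tail y₁) * Γ.arr k y₁) +
      z ^ Γ.index [y₂] • (pathSum hΓ z (.source i) (Γ.tail y₂) * Γ.arr k y₂) := fun hz i =>
    pathSum_eq_add_head hΓ hz h.head₁ h.head₂ h.ne fun p hp => by
      rcases List.eq_nil_or_concat p with rfl | ⟨q, e, rfl⟩
      · cases hp
      · rw [List.concat_eq_append] at hp ⊢
        rcases h.eq_of_head e (isPath_append_cons.1 hp).2 with rfl | rfl <;> simp
  have hid := fun (z : k) (c : NetVertex m n V) => idAt_mul_pathSum hΓ z (.inner v) c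
  simp only [map_add, pairSum_pairTerm, map_smul, tau_tmul, hΦ, dress_tmul, h.head₁, h.head₂,
    h.isBlack.1, mul_assoc, hid]
  simp only [hin hlam, hin hmu, hout hlam, hout hmu, add_mul, smul_mul_assoc, mul_smul_comm,
    TensorProduct.tmul_add, TensorProduct.add_tmul, ← TensorProduct.smul_tmul',
    TensorProduct.tmul_smul, smul_smul, smul_add, mul_assoc]
  module

omit [Fintype E] in
theorem sum_smul_tmul_sum_smul (s t : Finset (List E)) (f g : List E → k) :
    (∑ p ∈ s, f p • Γ.weight p) ⊗ₜ[k] (∑ q ∈ t, g q • Γ.weight q) =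
      ∑ p ∈ s, ∑ q ∈ t, (f p * g q) • (Γ.weight p ⊗ₜ[k] Γ.weight q : Γ.PathAlg k ⊗[k] Γ.PathAlg k) := by
  rw [TensorProduct.sum_tmul]
  simp only [TensorProduct.tmul_sum, TensorProduct.smul_tmul_smul]

/-- The tails are placed as is allowed when `e` and `f` leave the same vertex, so that each tensor
factor becomes a sum over the paths through one edge. The edge belongs to the final part of its
path, so `e` carries `lam`. -/
theorem dress_out_eq_sum (hΓ : Γ.IsAcyclic) {lam mu : k} (hlam : lam ≠ 0) (hmu : mu ≠ 0)
    (a b : Fin m) (j l : Fin n) (e f : E) :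
    dress (lam ^ Γ.index [e] * mu ^ Γ.index [f])
        (pathSum hΓ mu (.source a) (Γ.tail e)) (pathSum hΓ lam (.source b) (Γ.tail f))
        (pathSum hΓ lam (Γ.head e) (.sink j)) (pathSum hΓ mu (Γ.head f) (.sink l))
        (Γ.arr k e ⊗ₜ Γ.arr k f) =
      ∑ p ∈ paths hΓ (.source a) (.sink j), ∑ q ∈ paths hΓ (.source b) (.sink l),
        Γ.outTerm lam mu p q e f • (Γ.weight p ⊗ₜ Γ.weight q) := by
  rw [dress_tmul, pathSum_mul_arr_mul_pathSum, pathSum_mul_arr_mul_pathSum]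
  simp only [← ite_zero_smul]
  rw [sum_smul_tmul_sum_smul, Finset.smul_sum]
  refine Finset.sum_congr rfl fun p _ => ?_
  rw [Finset.smul_sum]
  refine Finset.sum_congr rfl fun q _ => ?_
  rw [smul_smul]
  congr 1
  unfold outTerm
  by_cases hp : e ∈ p <;> by_cases hq : f ∈ q <;> simp [hp, hq]
  simp only [zpow_sub₀ hlam, zpow_add₀ hmu, zpow_sub₀ hmu]
  field_simp

/-- The counterpart for edges with a common head: now the edge belongs to the initial part of its
path, so `e` carries `mu`. -/
theorem dress_in_eq_sum (hΓ : Γ.IsAcyclic) {lam mu : k} (hlam : lam ≠ 0) (hmu : mu ≠ 0)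
    (a b : Fin m) (j l : Fin n) (e f : E) :
    dress (lam ^ Γ.index [f] * mu ^ Γ.index [e])
        (pathSum hΓ mu (.source a) (Γ.tail e)) (pathSum hΓ lam (.source b) (Γ.tail f))
        (pathSum hΓ lam (Γ.head e) (.sink j)) (pathSum hΓ mu (Γ.head f) (.sink l))
        (Γ.arr k e ⊗ₜ Γ.arr k f) =
      ∑ p ∈ paths hΓ (.source a) (.sink j), ∑ q ∈ paths hΓ (.source b) (.sink l),
        Γ.inTerm lam mu p q e f • (Γ.weight p ⊗ₜ Γ.weight q) := by
  rw [dress_tmul, pathSum_mul_arr_mul_pathSum, pathSum_mul_arr_mul_pathSum]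
  simp only [← ite_zero_smul]
  rw [sum_smul_tmul_sum_smul, Finset.smul_sum]
  refine Finset.sum_congr rfl fun p _ => ?_
  rw [Finset.smul_sum]
  refine Finset.sum_congr rfl fun q _ => ?_
  rw [smul_smul]
  congr 1
  unfold inTerm
  by_cases hp : e ∈ p <;> by_cases hq : f ∈ q <;> simp [hp, hq]
  simp only [zpow_add₀ hlam, zpow_sub₀ hlam, zpow_add₀ hmu, zpow_sub₀ hmu]
  field_simp

end CylNetwork

/-! ### Entries of the trigonometric `r`-matrix. -/

open scoped Kronecker in
theorem trigRMatrix_apply {k : Type*} [Field k] (n : ℕ) (lam mu : k) (a b c d : Fin n) :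
    trigRMatrix n lam mu (a, b) (c, d) =
      if c = b ∧ d = a then CylNetwork.trigCoeff lam mu a b else 0 := by
  have h₁ : (∑ x : Fin n, Matrix.single x x (1 : k) ⊗ₖ Matrix.single x x (1 : k)) (a, b) (c, d) =
      if c = b ∧ d = a ∧ a = b then 1 else 0 := by
    rw [Matrix.sum_apply, Finset.sum_eq_single a]
    · simp only [Matrix.kroneckerMap_apply, Matrix.single_apply, mul_ite, mul_one, mul_zero]
      split_ifs <;> grind
    · intro x _ hx
      simp [Matrix.kroneckerMap_apply, Matrix.single_apply, hx]
    · simp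
  have h₂ : (∑ i : Fin n, ∑ j : Fin n, if i < j then
        lam • Matrix.single i j (1 : k) ⊗ₖ Matrix.single j i (1 : k) +
        mu • Matrix.single j i (1 : k) ⊗ₖ Matrix.single i j (1 : k)
      else 0) (a, b) (c, d) =
      if c = b ∧ d = a then (if a < b then lam else if b < a then mu else 0) else 0 := by
    have : ∀ i j : Fin n, (if i < j then
        lam • Matrix.single i j (1 : k) ⊗ₖ Matrix.single j i (1 : k) +
        mu • Matrix.single j i (1 : k) ⊗ₖ Matrix.single i j (1 : k)
      else 0) (a, b) (c, d) =
      (if i = a then (if j = b then (if c = b ∧ d = a ∧ a < b then lam else 0) else 0) else 0) +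
      (if i = b then (if j = a then (if c = b ∧ d = a ∧ b < a then mu else 0) else 0) else 0) := by
      intro i j
      by_cases hij : i < j
      · rw [if_pos hij]
        simp only [Matrix.add_apply, Matrix.smul_apply, Matrix.kroneckerMap_apply,
          Matrix.single_apply, mul_ite, mul_one, mul_zero, smul_eq_mul]
        congr 1
        · split_ifs <;> simp_all
        · split_ifs <;> simp_all
      · rw [if_neg hij]
        have h₁ : ¬ (i = a ∧ j = b ∧ a < b) := by rintro ⟨rfl, rfl, h⟩; exact hij h
        have h₂ : ¬ (i = b ∧ j = a ∧ b < a) := by rintro ⟨rfl, rfl, h⟩; exact hij h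
        split_ifs <;> simp_all
    have single : ∀ (a b : Fin n) (x : k),
        ∑ i, ∑ j, (if i = a then (if j = b then x else 0) else 0) = x := by
      intro a b x
      rw [Finset.sum_eq_single a (fun i _ hi => by simp [hi]) (by simp)]
      simp
    simp only [Matrix.sum_apply, this, Finset.sum_add_distrib, single]
    by_cases h : c = b ∧ d = a
    · rcases lt_trichotomy a b with h' | h' | h' <;> simp [h, h', h'.not_gt]
    · have h' : ∀ P : Prop, ¬ (c = b ∧ d = a ∧ P) := fun P hP => h ⟨hP.1, hP.2.1⟩
      simp [h, h']
  unfold trigRMatrix CylNetwork.trigCoeff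
  rw [Matrix.add_apply, Matrix.smul_apply, Matrix.smul_apply, h₁, h₂]
  by_cases h : c = b ∧ d = a
  · obtain ⟨rfl, rfl⟩ := h
    rcases lt_trichotomy d c with h | rfl | h
    · simp [h, h.ne, div_eq_inv_mul]
    · simp
    · simp [h, h.ne', h.not_gt, div_eq_inv_mul]
  · have h' : ¬ (c = b ∧ d = a ∧ a = b) := fun h' => h ⟨h'.1, h'.2.1⟩
    simp [h, h']

/-! ### From pairs of paths to the matrix identity. -/

namespace CylNetwork

variable {m n : ℕ} {V E : Type*} {Γ : CylNetwork m n V E} {k : Type*} [Field k]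
  [Fintype V] [Fintype E]

open Classical in
/-- The double bracket of two boundary measurements, as a sum over pairs of paths with exchanged
ends. -/
theorem doubleBracket_eq_sum (hΓ : Γ.IsPerfectCylindrical) {w : Weights k} (hw : w.IsStandard)
    {lam mu : k} (hlam : lam ≠ 0) (hmu : mu ≠ 0) (a b : Fin m) (j l : Fin n) :
    Γ.doubleBracket w (Γ.boundaryMeasurement lam b j) (Γ.boundaryMeasurement mu a l) =
      ∑ p ∈ paths hΓ.acyclic (.source a) (.sink j), ∑ q ∈ paths hΓ.acyclic (.source b) (.sink l),
        (∑ v : V, ∑ x₁, ∑ x₂, ∑ x₃,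
          ((if Γ.IsWhite v x₁ x₂ x₃ then
              1 / 2 * (Γ.outTerm lam mu p q x₁ x₂ - Γ.outTerm lam mu p q x₂ x₁) else 0) +
            if Γ.IsBlack v x₁ x₂ x₃ then
              1 / 2 * (Γ.inTerm lam mu p q x₁ x₂ - Γ.inTerm lam mu p q x₂ x₁) else 0)) •
          (Γ.weight p ⊗ₜ[k] Γ.weight q) := by
  rw [doubleBracket_boundaryMeasurement hΓ.acyclic w hlam hmu, edgeBracket_eq_sum, map_sum]
  simp only [Finset.sum_smul (s := (Finset.univ : Finset V))]
  rw [Finset.sum_congr rfl fun p _ => Finset.sum_comm, Finset.sum_comm]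
  refine Finset.sum_congr rfl fun v _ => ?_
  have hsub : ∀ T T' : List E → List E → k,
      (1 / 2 : k) • ((∑ p ∈ paths hΓ.acyclic (.source a) (.sink j),
          ∑ q ∈ paths hΓ.acyclic (.source b) (.sink l), T p q • ((Γ.weight p : Γ.PathAlg k) ⊗ₜ[k] (Γ.weight q : Γ.PathAlg k))) -
        ∑ p ∈ paths hΓ.acyclic (.source a) (.sink j),
          ∑ q ∈ paths hΓ.acyclic (.source b) (.sink l), T' p q • ((Γ.weight p : Γ.PathAlg k) ⊗ₜ[k] (Γ.weight q : Γ.PathAlg k))) =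
      ∑ p ∈ paths hΓ.acyclic (.source a) (.sink j),
        ∑ q ∈ paths hΓ.acyclic (.source b) (.sink l),
          (1 / 2 * (T p q - T' p q)) • ((Γ.weight p : Γ.PathAlg k) ⊗ₜ[k] (Γ.weight q : Γ.PathAlg k)) := by
    intro T T'
    simp only [← Finset.sum_sub_distrib, ← sub_smul, Finset.smul_sum, smul_smul]
  rcases whiteAt_or_blackAt hΓ.perfect hΓ.embedded v with ⟨x₁, x₂, x₃, h⟩ | ⟨x₁, x₂, x₃, h⟩
  · rw [h.sum_eq]
    refine (white_bracket w hΓ.acyclic h hlam hmu a b j l fun _ _ => rfl).trans ?_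
    rw [hw.1]
    have e₁ := dress_out_eq_sum hΓ.acyclic hlam hmu a b j l x₁ x₂
    have e₂ := dress_out_eq_sum hΓ.acyclic hlam hmu a b j l x₂ x₁
    rw [h.tail₁, h.tail₂] at e₁ e₂
    rw [h.tail₁, h.tail₂, e₁, e₂, hsub]
    refine Finset.sum_congr rfl fun p _ => Finset.sum_congr rfl fun q _ => ?_
    rw [h.sum_eq]
  · rw [h.sum_eq]
    refine (black_bracket w hΓ.acyclic h hlam hmu a b j l fun _ _ => rfl).trans ?_
    rw [hw.2]
    have e₁ := dress_in_eq_sum hΓ.acyclic hlam hmu a b j l x₁ x₂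
    have e₂ := dress_in_eq_sum hΓ.acyclic hlam hmu a b j l x₂ x₁
    rw [h.head₁, h.head₂] at e₁ e₂
    -- In the first term the first tensor factor passes through `x₂`, the reverse of the white case;
    -- this absorbs the minus sign of `-1/2`.
    rw [h.head₁, h.head₂, e₁, e₂, neg_smul, ← smul_neg, neg_sub, hsub]
    refine Finset.sum_congr rfl fun p _ => Finset.sum_congr rfl fun q _ => ?_
    rw [h.sum_eq]

theorem doubleBracket_boundaryMeasurement_eq [NeZero (2 : k)] (hΓ : Γ.IsPerfectCylindrical)
    {w : Weights k} (hw : w.IsStandard) {lam mu : k} (hlam : lam ≠ 0) (hmu : mu ≠ 0)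
    (hne : lam ≠ mu) (a b : Fin m) (j l : Fin n) :
    Γ.doubleBracket w (Γ.boundaryMeasurement lam b j) (Γ.boundaryMeasurement mu a l) =
      trigCoeff lam mu b a •
          (Γ.boundaryMeasurement lam a j ⊗ₜ[k] Γ.boundaryMeasurement mu b l) -
        trigCoeff lam mu l j •
          (Γ.boundaryMeasurement mu a j ⊗ₜ[k] Γ.boundaryMeasurement lam b l) := by
  rw [doubleBracket_eq_sum hΓ hw hlam hmu]
  simp only [boundaryMeasurement_eq_sum hΓ.acyclic, sum_smul_tmul_sum_smul, Finset.smul_sum,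
    smul_smul, ← Finset.sum_sub_distrib, ← sub_smul]
  refine Finset.sum_congr rfl fun p hp => Finset.sum_congr rfl fun q hq => ?_
  rw [sum_localTerms hlam hmu hne hΓ ((mem_paths _).1 hp) ((mem_paths _).1 hq)]

open scoped Kronecker in
omit [Fintype E] in
theorem kronecker_leftMat_rightMat_apply {I J I' J' : Type*} (X : Matrix I J (Γ.PathAlg k))
    (Y : Matrix I' J' (Γ.PathAlg k)) (p : I × I') (q : J × J') :
    (Γ.leftMat X ⊗ₖ Γ.rightMat Y) p q = X p.1 q.1 ⊗ₜ Y p.2 q.2 := by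
  simp [leftMat, rightMat, Matrix.kroneckerMap_apply]

open scoped Kronecker in
/-- The double bracket of the boundary measurement matrices is given by the trigonometric
`r`-matrices. -/
theorem matrixBracket_boundaryMeasurement [NeZero (2 : k)] (hΓ : Γ.IsPerfectCylindrical)
    {w : Weights k} (hw : w.IsStandard) {lam mu : k} (hlam : lam ≠ 0) (hmu : mu ≠ 0)
    (hne : lam ≠ mu) :
    Γ.matrixBracket w (Γ.boundaryMeasurement lam) (Γ.boundaryMeasurement mu) =
      Γ.scalarMat (trigRMatrix m lam mu) *
          (Γ.leftMat (Γ.boundaryMeasurement lam) ⊗ₖ Γ.rightMat (Γ.boundaryMeasurement mu)) -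
        Γ.tauMat ((Γ.leftMat (Γ.boundaryMeasurement lam) ⊗ₖ
          Γ.rightMat (Γ.boundaryMeasurement mu)) * Γ.scalarMat (trigRMatrix n lam mu)) := by
  -- In row `(b, a)` the matrix `r_m` is supported at column `(a, b)`, which exchanges the sources;
  -- in column `(j, l)` the matrix `r_n` is supported at row `(l, j)`, which exchanges the sinks. In
  -- the second term `τ` puts the factor starting at `a` first.
  ext ⟨b, a⟩ ⟨j, l⟩
  refine (doubleBracket_boundaryMeasurement_eq hΓ hw hlam hmu hne a b j l).trans ?_
  rw [Matrix.sub_apply]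
  congr 1
  · rw [Matrix.mul_apply, Finset.sum_eq_single (a, b)]
    · rw [kronecker_leftMat_rightMat_apply]
      simp [scalarMat, trigRMatrix_apply, Algebra.smul_def]
    · rintro ⟨c, d⟩ - hcd
      rw [Ne, Prod.mk.injEq] at hcd
      simp [scalarMat, trigRMatrix_apply, hcd]
    · simp
  · rw [tauMat, Matrix.map_apply, Matrix.mul_apply, Finset.sum_eq_single (l, j)]
    · rw [kronecker_leftMat_rightMat_apply]
      simp only [scalarMat, Matrix.map_apply, trigRMatrix_apply, and_self, if_true]
      rw [← Algebra.commutes, ← Algebra.smul_def, map_smul, tau_tmul]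
    · rintro ⟨c, d⟩ - hcd
      rw [Ne, Prod.mk.injEq] at hcd
      have : ¬ (j = d ∧ l = c) := fun h => hcd ⟨h.2.symm, h.1.symm⟩
      simp [scalarMat, trigRMatrix_apply, this]
    · simp

end CylNetwork

theorem specLam_ne_zero : specLam ≠ 0 := by
  unfold specLam
  rw [Ne, FaithfulSMul.algebraMap_eq_zero_iff]
  exact MvPolynomial.X_ne_zero 0

theorem specMu_ne_zero : specMu ≠ 0 := by
  unfold specMu
  rw [Ne, FaithfulSMul.algebraMap_eq_zero_iff]
  exact MvPolynomial.X_ne_zero 1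

theorem specLam_ne_specMu : specLam ≠ specMu := by
  unfold specLam specMu
  intro h
  have h' := FaithfulSMul.algebraMap_injective (MvPolynomial (Fin 2) ℂ) SpectralField h
  exact absurd (MvPolynomial.X_injective h') (by decide)

open CylNetwork in
open scoped Kronecker in
theorem mainTheorem2 :
    (∀ (m n : ℕ) (V E : Type) [Fintype V] [Fintype E] (Γ : CylNetwork m n V E)
      (w : Weights SpectralField), Γ.IsPerfectCylindrical → w.IsStandard →
      Γ.matrixBracket w (Γ.boundaryMeasurement specLam) (Γ.boundaryMeasurement specMu) =
        Γ.scalarMat (trigRMatrix m specLam specMu) *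
            (Γ.leftMat (Γ.boundaryMeasurement specLam) ⊗ₖ
              Γ.rightMat (Γ.boundaryMeasurement specMu)) -
          Γ.tauMat
            ((Γ.leftMat (Γ.boundaryMeasurement specLam) ⊗ₖ
              Γ.rightMat (Γ.boundaryMeasurement specMu)) *
              Γ.scalarMat (trigRMatrix n specLam specMu))) ∧
    (∀ (n : ℕ) (V E : Type) [Fintype V] [Fintype E] (Γ : CylNetwork n n V E)
      (w : Weights SpectralField), Γ.IsPerfectCylindrical → w.IsStandard →
      Γ.matrixBracket w (Γ.boundaryMeasurement specLam) (Γ.boundaryMeasurement specMu) =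
        Γ.twistedCommutator (Γ.scalarMat (trigRMatrix n specLam specMu))
          (Γ.leftMat (Γ.boundaryMeasurement specLam) ⊗ₖ
            Γ.rightMat (Γ.boundaryMeasurement specMu))) := by
  have : NeZero (2 : SpectralField) := ⟨by
    have h : (2 : MvPolynomial (Fin 2) ℂ) ≠ 0 := two_ne_zero
    rwa [← map_ofNat (algebraMap (MvPolynomial (Fin 2) ℂ) SpectralField) 2, Ne,
      FaithfulSMul.algebraMap_eq_zero_iff]⟩
  have key : ∀ (m n : ℕ) (V E : Type) [Fintype V] [Fintype E] (Γ : CylNetwork m n V E)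
      (w : Weights SpectralField), Γ.IsPerfectCylindrical → w.IsStandard → _ :=
    fun m n V E _ _ Γ w hΓ hw => Γ.matrixBracket_boundaryMeasurement hΓ hw
      specLam_ne_zero specMu_ne_zero specLam_ne_specMu
  -- For `m = n` the right-hand side unfolds to the twisted commutator.
  exact ⟨key, fun n V E _ _ Γ w hΓ hw => key n n V E Γ w hΓ hw⟩
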